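/- Let $\Gamma\in\mathbb R^{d_y\times d_y}$ and $\Sigma\in\mathbb R^{d_u\times d_u}$ be symmetric positive definite, $\mathcal G:\mathbb R^{d_u}\to\mathbb R^{d_y}$, $y\in\mathbb R^{d_y}$, and put $$\mathcal H(u)=\begin{bmatrix}\mathcal G(u)\\u\end{bmatrix},\quad z=\begin{bmatrix}y\\0\end{bmatrix},\quad \Gamma_+=\begin{bmatrix}\Gamma&0\\0&\Sigma\end{bmatrix},\quad \ell(u)=(\mathcal G(u)-y)^T\Gamma^{-1}(\mathcal G(u)-y)+u^T\Sigma^{-1}u .$$ Assume that $\mathcal H$ is twice differentiable with bounded first and second derivatives. For $n\ge0$ let $u_n^{(1)},\dots,u_n^{(K)}\in\mathbb R^{d_u}$ be an ensemble with sample mean $m_n$, let $\overline{\mathcal H}_n=\frac1K\sum_i\mathcal H(u_n^{(i)})$, and let $C_n^{uu}=\frac1K\sum_i(u_n^{(i)}-m_n)(u_n^{(i)}-m_n)^T$, $C_n^{pp}=\frac1K\sum_i(\mathcal H(u_n^{(i)})-\overline{\mathcal H}_n)(\mathcal H(u_n^{(i)})-\overline{\mathcal H}_n)^T$, $C_n^{pu}=\frac1K\sum_i(\mathcal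 H(u_n^{(i)})-\overline{\mathcal H}_n)(u_n^{(i)}-m_n)^T$, $C_n^{up}=(C_n^{pu})^T$. Suppose that the ensembles form a run of Tikhonov ensemble Kalman inversion, that is, for all $n\ge0$, $$m_{n+1}=m_n+C_n^{up}(C_n^{pp}+h_n^{-1}\Gamma_+)^{-1}(z-\mathcal H(m_n)),$$ $$C_{n+1}^{uu}=C_n^{uu}-C_n^{up}(C_n^{pp}+h_n^{-1}\Gamma_+)^{-1}C_n^{pu}+a_n\Sigma ,$$ where $h_n>0$ and $a_n>0$ for all $n\ge 0$, and $h_n=\mathsf h\,n^\beta$, $a_n=\mathsf a^2\mathsf h^{-1}n^{2\gamma-\beta-2}$ for $n\ge1$, with constants $\mathsf h,\mathsf a>0$, $\gamma-1\le\beta\le\gamma$ and $0\le\gamma<1$ (at $n=0$, where these formulas are not meaningful, the step size and the inflation may be any positive numbers). Suppose that there is $\lambda_c>0$ with $$\ell(x)-\ell(v)\ge\langle\nabla\ell(v),x-v\rangle+\lambda_c\|x-v\|^2\quad\text{for all }x,v\in\mathbb R^{d_u}.$$ Then there are constants $\kappa_m,\kappa_M>0$ with $\kappa_m n^{\gamma-\beta-1}\Sigma\preceq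 C_n^{uu}\preceq\kappa_M n^{\gamma-\beta-1}\Sigma$ for all $n\ge1$; the function $\ell$ has a unique global minimizer $u^*$, and $\lambda_c\|m_N-u^*\|^2\le\ell(m_N)-\ell(u^*)$ for all $N$. Moreover: 1. If $\gamma=0$, then for every $\kappa_m>0$ such that $\kappa_m n^{\gamma-\beta-1}\Sigma\preceq C_n^{uu}$ for all $n\ge1$, there are $n_0$ and $D$ such that $$\ell(m_N)-\ell(u^*)\le\frac{D}{N^\alpha}\quad\text{for all }N\ge n_0\text{ and all }0<\alpha<\min\Bigl\{\frac{1+\beta}2,\ \mathsf h\,\kappa_m\sigma_m\lambda_c\Bigr\},$$ where $\sigma_m$ is the smallest eigenvalue of $\Sigma$. 2. If $0<\gamma<1$, then there are $n_0$ and $D$ such that $$\ell(m_N)-\ell(u^*)\le\frac{D}{N^\alpha}\quad\text{for all }N\ge n_0\text{ and all }0<\alpha<\frac{1+\beta-\gamma}2 .$$ -/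

import Mathlib

namespace EKI

noncomputable section

/-- The squared Mahalanobis norm `‖v‖²_A = vᵀ A⁻¹ v`. -/
def mahalanobisSq {ι : Type*} [Fintype ι] [DecidableEq ι]
    (A : Matrix ι ι ℝ) (v : EuclideanSpace ℝ ι) : ℝ :=
  v.ofLp ⬝ᵥ (A⁻¹).mulVec v.ofLp

/-- The smallest eigenvalue of a real symmetric matrix. -/
def minEigenvalue {ι : Type*} [Fintype ι] [DecidableEq ι]
    {A : Matrix ι ι ℝ} (hA : A.IsHermitian) : ℝ :=
  ⨅ i, hA.eigenvalues i

/-- The extended observation map `H(u) = (G(u), u)`. -/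
def obs {du dy : ℕ} (G : EuclideanSpace ℝ (Fin du) → EuclideanSpace ℝ (Fin dy))
    (u : EuclideanSpace ℝ (Fin du)) : EuclideanSpace ℝ (Fin dy ⊕ Fin du) :=
  WithLp.toLp 2 (Sum.elim (G u).ofLp u.ofLp)

/-- The extended data `z = (y, 0)`. -/
def extData {dy : ℕ} (du : ℕ) (y : EuclideanSpace ℝ (Fin dy)) :
    EuclideanSpace ℝ (Fin dy ⊕ Fin du) :=
  WithLp.toLp 2 (Sum.elim y.ofLp 0)

/-- The extended noise covariance `Γ₊ = diag(Γ, S)`. -/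
def extCov {du dy : ℕ} (Γ : Matrix (Fin dy) (Fin dy) ℝ) (S : Matrix (Fin du) (Fin du) ℝ) :
    Matrix (Fin dy ⊕ Fin du) (Fin dy ⊕ Fin du) ℝ :=
  Matrix.fromBlocks Γ 0 0 S

/-- The Tikhonov-regularized loss `ℓ(u) = ‖G(u) - y‖²_Γ + ‖u‖²_S`. -/
def loss {du dy : ℕ} (G : EuclideanSpace ℝ (Fin du) → EuclideanSpace ℝ (Fin dy))
    (y : EuclideanSpace ℝ (Fin dy)) (Γ : Matrix (Fin dy) (Fin dy) ℝ)
    (S : Matrix (Fin du) (Fin du) ℝ) (u : EuclideanSpace ℝ (Fin du)) : ℝ :=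
  mahalanobisSq Γ (G u - y) + mahalanobisSq S u

/-- The mean of an ensemble of `K` vectors. -/
def sampleMean {ι : Type*} {K : ℕ} (x : Fin K → EuclideanSpace ℝ ι) : EuclideanSpace ℝ ι :=
  (K : ℝ)⁻¹ • ∑ i, x i

/-- The sample cross covariance `(1/K) ∑ᵢ (xᵢ - x̄) ⊗ (yᵢ - ȳ)` of two ensembles. -/
def sampleCov {ι κ : Type*} {K : ℕ} (x : Fin K → EuclideanSpace ℝ ι)
    (y : Fin K → EuclideanSpace ℝ κ) : Matrix ι κ ℝ :=
  (K : ℝ)⁻¹ • ∑ i, Matrix.vecMulVec (x i - sampleMean x).ofLp (y i - sampleMean y).ofLp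

/-- `C^{uu}` of an ensemble. -/
def covUU {du K : ℕ} (u : Fin K → EuclideanSpace ℝ (Fin du)) : Matrix (Fin du) (Fin du) ℝ :=
  sampleCov u u

/-- `C^{pp}` of an ensemble. -/
def covPP {du dy K : ℕ} (G : EuclideanSpace ℝ (Fin du) → EuclideanSpace ℝ (Fin dy))
    (u : Fin K → EuclideanSpace ℝ (Fin du)) :
    Matrix (Fin dy ⊕ Fin du) (Fin dy ⊕ Fin du) ℝ :=
  sampleCov (fun i => obs G (u i)) (fun i => obs G (u i))

/-- `C^{pu}` of an ensemble. -/
def covPU {du dy K : ℕ} (G : EuclideanSpace ℝ (Fin du) → EuclideanSpace ℝ (Fin dy))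
    (u : Fin K → EuclideanSpace ℝ (Fin du)) : Matrix (Fin dy ⊕ Fin du) (Fin du) ℝ :=
  sampleCov (fun i => obs G (u i)) u

/-- `C^{up} = (C^{pu})ᵀ` of an ensemble. -/
def covUP {du dy K : ℕ} (G : EuclideanSpace ℝ (Fin du) → EuclideanSpace ℝ (Fin dy))
    (u : Fin K → EuclideanSpace ℝ (Fin du)) : Matrix (Fin du) (Fin dy ⊕ Fin du) ℝ :=
  (covPU G u).transpose

/-- The Kalman gain `C^{up} (C^{pp} + h⁻¹ Γ₊)⁻¹` for the step size `h`. -/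
def gain {du dy K : ℕ} (G : EuclideanSpace ℝ (Fin du) → EuclideanSpace ℝ (Fin dy))
    (Γ : Matrix (Fin dy) (Fin dy) ℝ) (S : Matrix (Fin du) (Fin du) ℝ) (h : ℝ)
    (u : Fin K → EuclideanSpace ℝ (Fin du)) : Matrix (Fin du) (Fin dy ⊕ Fin du) ℝ :=
  covUP G u * (covPP G u + h⁻¹ • extCov Γ S)⁻¹

/-- `u` is a run of Tikhonov ensemble Kalman inversion (square-root form) with step sizes `h n`
and covariance inflation `a n • S`: the mean and the covariance of the ensemble
`u n = (u_n^{(1)}, …, u_n^{(K)})` follow the update rules, and the ensemble is otherwise free. -/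
structure IsEKI {du dy K : ℕ} (G : EuclideanSpace ℝ (Fin du) → EuclideanSpace ℝ (Fin dy))
    (y : EuclideanSpace ℝ (Fin dy)) (Γ : Matrix (Fin dy) (Fin dy) ℝ)
    (S : Matrix (Fin du) (Fin du) ℝ) (h a : ℕ → ℝ)
    (u : ℕ → Fin K → EuclideanSpace ℝ (Fin du)) : Prop where
  mean_update : ∀ n, sampleMean (u (n + 1)) = sampleMean (u n) +
    WithLp.toLp 2 ((gain G Γ S (h n) (u n)).mulVec
      (extData du y - obs G (sampleMean (u n))).ofLp)
  cov_update : ∀ n, covUU (u (n + 1)) =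
    covUU (u n) - gain G Γ S (h n) (u n) * covPU G (u n) + a n • S

/-- Bounded first and second order derivatives. -/
def HasBoundedDerivs {E F : Type*} [NormedAddCommGroup E] [NormedSpace ℝ E]
    [NormedAddCommGroup F] [NormedSpace ℝ F] (H : E → F) : Prop :=
  Differentiable ℝ H ∧ Differentiable ℝ (fderiv ℝ H) ∧
    ∃ M₁ M₂ : ℝ,
      (∀ x, ‖fderiv ℝ H x‖ ≤ M₁) ∧
      (∀ x x', ‖H x' - H x‖ ≤ M₁ * ‖x' - x‖) ∧
      (∀ x v, ‖fderiv ℝ (fderiv ℝ H) x v v‖ ≤ M₂ * ‖v‖ ^ 2)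

/-- Strong convexity with constant `c`, in first order form. -/
def StronglyConvexWith {E : Type*} [NormedAddCommGroup E] [InnerProductSpace ℝ E]
    [CompleteSpace E] (f : E → ℝ) (c : ℝ) : Prop :=
  ∀ x y, f x - f y ≥ inner ℝ (gradient f y) (x - y) + c * ‖x - y‖ ^ 2

/-- `κ n^{γ-β-1} S ⪯ C^{uu}_n` for all `n ≥ 1`. -/
def CovLowerBound {du K : ℕ} (S : Matrix (Fin du) (Fin du) ℝ) (β γ : ℝ)
    (u : ℕ → Fin K → EuclideanSpace ℝ (Fin du)) (κ : ℝ) : Prop :=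
  ∀ n : ℕ, 1 ≤ n → (covUU (u n) - (κ * (n : ℝ) ^ (γ - β - 1)) • S).PosSemidef

/-- `C^{uu}_n ⪯ κ n^{γ-β-1} S` for all `n ≥ 1`. -/
def CovUpperBound {du K : ℕ} (S : Matrix (Fin du) (Fin du) ℝ) (β γ : ℝ)
    (u : ℕ → Fin K → EuclideanSpace ℝ (Fin du)) (κ : ℝ) : Prop :=
  ∀ n : ℕ, 1 ≤ n → ((κ * (n : ℝ) ^ (γ - β - 1)) • S - covUU (u n)).PosSemidef

end

end EKI

/-!
The covariance is squeezed between multiples of `n ^ (γ - β - 1) • S` by a variational argument.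
The analysis covariance `C^{uu} - C^{up} (C^{pp} + h⁻¹ Γ₊)⁻¹ C^{pu}`, tested against `v`, is the
least mean squared error of a linear prediction of `⟨u, v⟩` from noisy observations of `H(u)`.
Since `u` is a part of `H(u)`, predicting from `u` alone shows that an upper bound `c S` is mapped
to `(c / (1 + h c) + a) S`, and this recursion preserves `κ n ^ (γ - β - 1)`
(`exists_covUpperBound`). The Lipschitz bound of `H` together with this upper bound shows that one
step shrinks the covariance by no more than a factor `1 + B n ^ (γ - 1)`; the inflation
compensates this loss (`exists_inner_covUU_le`, `exists_covLowerBound`).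

For the mean, put `P n = n ^ (1 + β - γ) C^{uu}_n`, `t n = n ^ (γ - 1)` and `e n = n ^ (-(1 + β -
γ) / 2)`. The ensemble has spread `O(e n)`, so by Taylor expansion of `H` the mean update is a
step `x ↦ x - t P (h₀ / 2 • ∇ℓ(x) + ω)` with `‖ω‖ = O(t ‖∇ℓ(x)‖ + e √ℓ(x))`
(`exists_innovation_approx`, `IsEKI.exists_isPreconditionedDescent`).

The gradient of `ℓ` need not be globally Lipschitz: its derivative can grow like `√ℓ`. Hence the
usual descent estimate is available only after the values `ℓ(x n)` are known to be bounded.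
Boundedness (`IsPreconditionedDescent.exists_forall_le`) follows from a Lyapunov function which
needs convexity only, the Moreau envelope `min_w ℓ(w) + μ ⟨x n - w, (P n)⁻¹ (x n - w)⟩` in the
moving metric of the preconditioner. That metric grows at most by a factor `1 + O(t n)` in one
step, and once `μ` is large, the decrease of the distance to the proximal point outweighs this
growth. With bounded values, the descent estimate and the inequality `4 c (ℓ - ℓ(u*)) ≤ ‖∇ℓ‖²`
give a scalar recursion (`IsEKI.eventually_gap_le`), whose solution decays at the stated rates
(`exists_le_rpow_neg_of_recursion`).
-/

open Matrix WithLp Filter Topology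

namespace EKI

/-! ### Quadratic forms of positive definite matrices -/

section Forms

variable {ι κ : Type*} [Fintype κ] [DecidableEq κ]

theorem toEuclideanLin_mul_apply {μ : Type*} [Fintype μ] [DecidableEq μ] (A : Matrix ι κ ℝ)
    (B : Matrix κ μ ℝ) (v : EuclideanSpace ℝ μ) :
    toEuclideanLin (A * B) v = toEuclideanLin A (toEuclideanLin B v) := by
  simp [toLpLin_apply, mulVec_mulVec]

variable [Fintype ι]

theorem inner_toEuclideanLin (A : Matrix ι κ ℝ) (x : EuclideanSpace ℝ ι)
    (v : EuclideanSpace ℝ κ) :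
    inner ℝ x (toEuclideanLin A v) = x.ofLp ⬝ᵥ A *ᵥ v.ofLp := by
  rw [EuclideanSpace.inner_eq_star_dotProduct]
  simp [toLpLin_apply, dotProduct_comm]

theorem exists_norm_toEuclideanLin_le (A : Matrix ι κ ℝ) :
    ∃ L : ℝ, 0 < L ∧ ∀ v, ‖toEuclideanLin A v‖ ≤ L * ‖v‖ := by
  refine ⟨‖(toEuclideanLin A).toContinuousLinearMap‖ + 1, by positivity, fun v => ?_⟩
  refine ((toEuclideanLin A).toContinuousLinearMap.le_opNorm v).trans ?_
  gcongr; linarith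

variable [DecidableEq ι]

theorem inner_toEuclideanLin_transpose (A : Matrix ι κ ℝ) (x : EuclideanSpace ℝ ι)
    (v : EuclideanSpace ℝ κ) :
    inner ℝ (toEuclideanLin Aᵀ x) v = inner ℝ x (toEuclideanLin A v) := by
  rw [real_inner_comm, inner_toEuclideanLin, inner_toEuclideanLin, mulVec_transpose,
    dotProduct_comm, dotProduct_mulVec]

theorem _root_.Matrix.IsHermitian.inner_toEuclideanLin_comm {A : Matrix ι ι ℝ} (hA : A.IsHermitian)
    (x v : EuclideanSpace ℝ ι) :
    inner ℝ (toEuclideanLin A x) v = inner ℝ x (toEuclideanLin A v) := by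
  have h : Aᵀ = A := by simpa [IsHermitian, conjTranspose_eq_transpose_of_trivial] using hA
  nth_rw 1 [← h]
  exact inner_toEuclideanLin_transpose A x v

theorem posSemidef_iff_inner {A : Matrix ι ι ℝ} :
    A.PosSemidef ↔ A.IsHermitian ∧ ∀ v, 0 ≤ inner ℝ v (toEuclideanLin A v) := by
  rw [posSemidef_iff_dotProduct_mulVec]
  refine and_congr_right fun _ => ⟨fun h v => ?_, fun h v => ?_⟩
  · rw [inner_toEuclideanLin]; simpa using h v.ofLp
  · have := h (toLp 2 v)
    rw [inner_toEuclideanLin] at this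
    simpa using this

theorem sum_eigenvalues_mul_inner_sq {A : Matrix ι ι ℝ} (hA : A.IsHermitian)
    (v : EuclideanSpace ℝ ι) :
    inner ℝ v (toEuclideanLin A v)
      = ∑ i, hA.eigenvalues i * inner ℝ (hA.eigenvectorBasis i) v ^ 2 := by
  rw [← OrthonormalBasis.sum_inner_mul_inner hA.eigenvectorBasis]
  refine Finset.sum_congr rfl fun i _ => ?_
  have h : toEuclideanLin A (hA.eigenvectorBasis i)
      = hA.eigenvalues i • hA.eigenvectorBasis i := by
    rw [toLpLin_apply, hA.mulVec_eigenvectorBasis]; rfl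
  rw [← hA.inner_toEuclideanLin_comm, h, inner_smul_left, real_inner_comm]
  simp; ring

theorem minEigenvalue_mul_norm_sq_le {A : Matrix ι ι ℝ} (hA : A.IsHermitian)
    (v : EuclideanSpace ℝ ι) :
    minEigenvalue hA * ‖v‖ ^ 2 ≤ inner ℝ v (toEuclideanLin A v) := by
  rw [sum_eigenvalues_mul_inner_sq hA, ← OrthonormalBasis.sum_sq_norm_inner_right
    hA.eigenvectorBasis, Finset.mul_sum]
  refine Finset.sum_le_sum fun i _ => ?_
  rw [Real.norm_eq_abs, sq_abs]
  exact mul_le_mul_of_nonneg_right (ciInf_le (Set.finite_range _).bddBelow i) (sq_nonneg _)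

theorem _root_.Matrix.PosDef.exists_pos_le_inner {A : Matrix ι ι ℝ} (hA : A.PosDef) :
    ∃ σ : ℝ, 0 < σ ∧ ∀ v, σ * ‖v‖ ^ 2 ≤ inner ℝ v (toEuclideanLin A v) := by
  rcases isEmpty_or_nonempty ι with h | h
  · refine ⟨1, one_pos, fun v => ?_⟩
    have : v = 0 := Subsingleton.elim _ _
    simp [this]
  · refine ⟨_, ?_, minEigenvalue_mul_norm_sq_le hA.isHermitian⟩
    obtain ⟨i, hi⟩ := exists_eq_ciInf_of_finite (f := hA.isHermitian.eigenvalues)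
    rw [minEigenvalue, ← hi]
    exact hA.eigenvalues_pos i

theorem _root_.Matrix.PosDef.toEuclideanLin_inv_apply {A : Matrix ι ι ℝ} (hA : A.PosDef)
    (v : EuclideanSpace ℝ ι) : toEuclideanLin A (toEuclideanLin A⁻¹ v) = v := by
  rw [← toEuclideanLin_mul_apply, mul_nonsing_inv _ ((isUnit_iff_isUnit_det A).1 hA.isUnit)]
  simp

theorem _root_.Matrix.PosDef.toEuclideanLin_apply_inv {A : Matrix ι ι ℝ} (hA : A.PosDef)
    (v : EuclideanSpace ℝ ι) : toEuclideanLin A⁻¹ (toEuclideanLin A v) = v := by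
  rw [← toEuclideanLin_mul_apply, nonsing_inv_mul _ ((isUnit_iff_isUnit_det A).1 hA.isUnit)]
  simp

/-- The variational inequality `⟨b, A⁻¹ b⟩ ≥ 2 ⟨w, b⟩ - ⟨w, A w⟩`, with equality at
`w = A⁻¹ b`. -/
theorem _root_.Matrix.PosDef.two_mul_inner_sub_le {A : Matrix ι ι ℝ} (hA : A.PosDef)
    (b w : EuclideanSpace ℝ ι) :
    2 * inner ℝ w b - inner ℝ w (toEuclideanLin A w) ≤ inner ℝ b (toEuclideanLin A⁻¹ b) := by
  set q := toEuclideanLin A⁻¹ b with hq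
  have hb : b = toEuclideanLin A q := (hA.toEuclideanLin_inv_apply b).symm
  have h := (posSemidef_iff_inner.1 hA.posSemidef).2 (q - w)
  have h1 := hA.isHermitian.inner_toEuclideanLin_comm q w
  rw [map_sub, inner_sub_left, inner_sub_right, inner_sub_right, ← h1, ← hb,
    real_inner_comm] at h
  rw [real_inner_comm w b] at h
  linarith [real_inner_comm w b]

/-- Inversion reverses the Loewner order, up to a scalar factor. -/
theorem _root_.Matrix.PosDef.inner_inv_le {A B : Matrix ι ι ℝ} (hA : A.PosDef) (hB : B.PosDef)
    {r : ℝ} (hr : 0 < r)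
    (h : ∀ v, inner ℝ v (toEuclideanLin A v) ≤ r * inner ℝ v (toEuclideanLin B v))
    (v : EuclideanSpace ℝ ι) :
    inner ℝ v (toEuclideanLin B⁻¹ v) ≤ r * inner ℝ v (toEuclideanLin A⁻¹ v) := by
  set q := toEuclideanLin B⁻¹ v with hq
  have hb : v = toEuclideanLin B q := (hB.toEuclideanLin_inv_apply v).symm
  have h1 := hA.two_mul_inner_sub_le v (r⁻¹ • q)
  have h2 := h q
  rw [← hb] at h2
  rw [map_smul, inner_smul_left, inner_smul_left, inner_smul_right] at h1
  simp only [conj_trivial] at h1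
  rw [real_inner_comm v q] at h2 h1
  have h3 : r * (2 * (r⁻¹ * inner ℝ v q) - r⁻¹ * (r⁻¹ * inner ℝ q (toEuclideanLin A q)))
      = 2 * inner ℝ v q - r⁻¹ * inner ℝ q (toEuclideanLin A q) := by
    field_simp
  have h4 : r⁻¹ * inner ℝ q (toEuclideanLin A q) ≤ inner ℝ v q := by
    rw [inv_mul_le_iff₀ hr]; exact h2
  have h5 := mul_le_mul_of_nonneg_left h1 hr.le
  linarith

end Forms

/-! ### Sample covariances -/

section Average

variable {K : ℕ}

/-- The average `(1/K) ∑ᵢ xᵢ`, equal to `0` if `K = 0`. -/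
noncomputable def avg {E : Type*} [AddCommGroup E] [Module ℝ E] (x : Fin K → E) : E :=
  (K : ℝ)⁻¹ • ∑ i, x i

theorem avg_mono {f g : Fin K → ℝ} (h : ∀ i, f i ≤ g i) : avg f ≤ avg g :=
  smul_le_smul_of_nonneg_left (Finset.sum_le_sum fun i _ => h i) (by positivity)

theorem avg_nonneg {f : Fin K → ℝ} (h : ∀ i, 0 ≤ f i) : 0 ≤ avg f :=
  smul_nonneg (by positivity) (Finset.sum_nonneg fun i _ => h i)

theorem avg_const_mul (r : ℝ) (f : Fin K → ℝ) : avg (fun i => r * f i) = r * avg f := by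
  simp only [avg, ← Finset.mul_sum, smul_eq_mul]; ring

theorem avg_add {E : Type*} [AddCommGroup E] [Module ℝ E] (f g : Fin K → E) :
    avg (fun i => f i + g i) = avg f + avg g := by
  simp [avg, Finset.sum_add_distrib]

theorem avg_sub {E : Type*} [AddCommGroup E] [Module ℝ E] (f g : Fin K → E) :
    avg (fun i => f i - g i) = avg f - avg g := by
  simp [avg, Finset.sum_sub_distrib, smul_sub]

theorem map_avg {E F : Type*} [AddCommGroup E] [Module ℝ E] [AddCommGroup F] [Module ℝ F]
    (f : E →ₗ[ℝ] F) (x : Fin K → E) : f (avg x) = avg fun i => f (x i) := by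
  simp [avg]

theorem inner_avg {E : Type*} [NormedAddCommGroup E] [InnerProductSpace ℝ E] (v : E)
    (x : Fin K → E) : inner ℝ v (avg x) = avg fun i => inner ℝ v (x i) := by
  simp [avg, inner_smul_right, inner_sum]

theorem norm_avg_le {E : Type*} [NormedAddCommGroup E] [NormedSpace ℝ E] {x : Fin K → E}
    {ρ : ℝ} (hρ : 0 ≤ ρ) (h : ∀ i, ‖x i‖ ≤ ρ) : ‖avg x‖ ≤ ρ := by
  rcases Nat.eq_zero_or_pos K with rfl | hK
  · simpa [avg] using hρ
  · have h1 : ‖∑ i, x i‖ ≤ K * ρ := by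
      simpa using norm_sum_le_of_le Finset.univ fun i _ => h i
    have hK' : (0 : ℝ) < K := by exact_mod_cast hK
    rw [avg, norm_smul, norm_inv, Real.norm_natCast, inv_mul_le_iff₀ hK']
    exact h1

theorem avg_const {E : Type*} [AddCommGroup E] [Module ℝ E] (hK : 0 < K) (v : E) :
    avg (fun _ : Fin K => v) = v := by
  have hK' : (K : ℝ) ≠ 0 := by exact_mod_cast hK.ne'
  rw [avg, Finset.sum_const, Finset.card_univ, Fintype.card_fin, ← Nat.cast_smul_eq_nsmul ℝ,
    smul_smul, inv_mul_cancel₀ hK', one_smul]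

theorem sampleMean_eq_avg {ι : Type*} (x : Fin K → EuclideanSpace ℝ ι) :
    sampleMean x = avg x := rfl

theorem avg_sub_sampleMean {ι : Type*} (x : Fin K → EuclideanSpace ℝ ι) :
    avg (fun i => x i - sampleMean x) = 0 := by
  rcases Nat.eq_zero_or_pos K with rfl | hK
  · simp [avg]
  · rw [avg_sub, avg_const hK, sampleMean_eq_avg, sub_self]

variable {ι κ : Type*}

theorem sampleCov_transpose (x : Fin K → EuclideanSpace ℝ ι)
    (y : Fin K → EuclideanSpace ℝ κ) : (sampleCov x y)ᵀ = sampleCov y x := by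
  ext i j
  simp [sampleCov, vecMulVec, Matrix.sum_apply, mul_comm]

variable [Fintype κ]

/-- The squared deviations of an ensemble sum up to `K` times the trace of its covariance. -/
theorem norm_sub_sampleMean_sq_le (y : Fin K → EuclideanSpace ℝ κ) (i : Fin K) :
    ‖y i - sampleMean y‖ ^ 2 ≤ K * (sampleCov y y).trace := by
  have hK : (K : ℝ) ≠ 0 := by exact_mod_cast (Fin.pos i).ne'
  have h : (K : ℝ) * (sampleCov y y).trace = ∑ j, ‖y j - sampleMean y‖ ^ 2 := by
    simp only [sampleCov, trace_smul, trace_sum, trace_vecMulVec, smul_eq_mul]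
    rw [mul_inv_cancel_left₀ hK]
    refine Finset.sum_congr rfl fun j _ => ?_
    rw [← real_inner_self_eq_norm_sq, EuclideanSpace.inner_eq_star_dotProduct]
    simp
  rw [h]
  exact Finset.single_le_sum (f := fun j => ‖y j - sampleMean y‖ ^ 2)
    (fun j _ => sq_nonneg _) (Finset.mem_univ i)

variable [DecidableEq κ]

theorem toEuclideanLin_sampleCov (x : Fin K → EuclideanSpace ℝ ι)
    (y : Fin K → EuclideanSpace ℝ κ) (w : EuclideanSpace ℝ κ) :
    toEuclideanLin (sampleCov x y) w
      = avg fun i => inner ℝ (y i - sampleMean y) w • (x i - sampleMean x) := by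
  have h : ∀ a : EuclideanSpace ℝ ι, ∀ b : EuclideanSpace ℝ κ,
      toEuclideanLin (vecMulVec a.ofLp b.ofLp) w = inner ℝ b w • a := by
    intro a b
    ext j
    rw [EuclideanSpace.inner_eq_star_dotProduct]
    simp [toLpLin_apply, vecMulVec_mulVec, dotProduct_comm]
  simp only [sampleCov, avg, map_smul, map_sum, LinearMap.smul_apply, LinearMap.sum_apply, h]

theorem inner_toEuclideanLin_sampleCov [Fintype ι] (x : Fin K → EuclideanSpace ℝ ι)
    (y : Fin K → EuclideanSpace ℝ κ) (v : EuclideanSpace ℝ ι) (w : EuclideanSpace ℝ κ) :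
    inner ℝ v (toEuclideanLin (sampleCov x y) w)
      = avg fun i => inner ℝ (x i - sampleMean x) v * inner ℝ (y i - sampleMean y) w := by
  rw [toEuclideanLin_sampleCov, inner_avg]
  congr 1; ext i
  rw [inner_smul_right, real_inner_comm v]; ring

theorem posSemidef_sampleCov (y : Fin K → EuclideanSpace ℝ κ) :
    (sampleCov y y).PosSemidef := by
  refine posSemidef_iff_inner.2 ⟨?_, fun v => ?_⟩
  · rw [IsHermitian, conjTranspose_eq_transpose_of_trivial, sampleCov_transpose]
  · rw [inner_toEuclideanLin_sampleCov]
    exact avg_nonneg fun i => mul_self_nonneg _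

end Average

/-! ### The extended observation -/

section Observation

variable {du dy K : ℕ}

theorem posDef_extCov {Γ : Matrix (Fin dy) (Fin dy) ℝ} {S : Matrix (Fin du) (Fin du) ℝ}
    (hΓ : Γ.PosDef) (hS : S.PosDef) : (extCov Γ S).PosDef := by
  refine PosDef.of_dotProduct_mulVec_pos
    (IsHermitian.fromBlocks hΓ.isHermitian (by simp) hS.isHermitian) fun x hx => ?_
  have hx' : x = Sum.elim (x ∘ Sum.inl) (x ∘ Sum.inr) := by simp
  have h : star x ⬝ᵥ fromBlocks Γ 0 0 S *ᵥ x
      = star (x ∘ Sum.inl) ⬝ᵥ Γ *ᵥ (x ∘ Sum.inl) + star (x ∘ Sum.inr) ⬝ᵥ S *ᵥ (x ∘ Sum.inr) := by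
    rw [fromBlocks_mulVec]
    simp only [star_trivial, zero_mulVec, add_zero, zero_add]
    rw [← sumElim_dotProduct_sumElim, ← hx']
  rw [extCov, h]
  have h1 := hΓ.posSemidef.dotProduct_mulVec_nonneg (x ∘ Sum.inl)
  have h2 := hS.posSemidef.dotProduct_mulVec_nonneg (x ∘ Sum.inr)
  by_cases hl : x ∘ Sum.inl = 0
  · have hr : x ∘ Sum.inr ≠ 0 := fun hr => hx (by rw [hx', hl, hr]; simp)
    linarith [hS.dotProduct_mulVec_pos hr]
  · linarith [hΓ.dotProduct_mulVec_pos hl]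

theorem extCov_inv {Γ : Matrix (Fin dy) (Fin dy) ℝ} {S : Matrix (Fin du) (Fin du) ℝ}
    (hΓ : Γ.PosDef) (hS : S.PosDef) : (extCov Γ S)⁻¹ = fromBlocks Γ⁻¹ 0 0 S⁻¹ := by
  refine inv_eq_left_inv ?_
  rw [extCov, fromBlocks_multiply, nonsing_inv_mul _ ((isUnit_iff_isUnit_det _).1 hΓ.isUnit),
    nonsing_inv_mul _ ((isUnit_iff_isUnit_det _).1 hS.isUnit)]
  simp

theorem loss_eq_inner (G : EuclideanSpace ℝ (Fin du) → EuclideanSpace ℝ (Fin dy))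
    (y : EuclideanSpace ℝ (Fin dy)) {Γ : Matrix (Fin dy) (Fin dy) ℝ}
    {S : Matrix (Fin du) (Fin du) ℝ} (hΓ : Γ.PosDef) (hS : S.PosDef)
    (x : EuclideanSpace ℝ (Fin du)) :
    loss G y Γ S x = inner ℝ (obs G x - extData du y)
      (toEuclideanLin (extCov Γ S)⁻¹ (obs G x - extData du y)) := by
  have h : (obs G x - extData du y).ofLp = Sum.elim (G x - y).ofLp x.ofLp := by
    ext (i | i) <;> simp [obs, extData]
  rw [inner_toEuclideanLin, extCov_inv hΓ hS, h, fromBlocks_mulVec, loss, mahalanobisSq,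
    mahalanobisSq]
  simp only [Sum.elim_comp_inl, Sum.elim_comp_inr, sumElim_dotProduct_sumElim, zero_mulVec,
    add_zero, zero_add]

end Observation

/-! ### One step of the covariance update -/

section Step

variable {du dy K : ℕ} {G : EuclideanSpace ℝ (Fin du) → EuclideanSpace ℝ (Fin dy)}
  {Γ : Matrix (Fin dy) (Fin dy) ℝ} {S : Matrix (Fin du) (Fin du) ℝ} {h : ℝ}
  {u : Fin K → EuclideanSpace ℝ (Fin du)}

/-- The deviation of the `i`-th ensemble member from the ensemble mean. -/
noncomputable def dev {ι : Type*} (x : Fin K → EuclideanSpace ℝ ι) (i : Fin K) :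
    EuclideanSpace ℝ ι :=
  x i - sampleMean x

theorem avg_dev {ι : Type*} (x : Fin K → EuclideanSpace ℝ ι) : avg (dev x) = 0 :=
  avg_sub_sampleMean x

theorem posDef_innovation (hΓ : Γ.PosDef) (hS : S.PosDef) (hh : 0 < h) :
    (covPP G u + h⁻¹ • extCov Γ S).PosDef :=
  PosDef.posSemidef_add (posSemidef_sampleCov _) ((posDef_extCov hΓ hS).smul (inv_pos.2 hh))

theorem inner_gain_mul_covPU (v : EuclideanSpace ℝ (Fin du)) :
    inner ℝ v (toEuclideanLin (gain G Γ S h u * covPU G u) v)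
      = inner ℝ (toEuclideanLin (covPU G u) v)
          (toEuclideanLin (covPP G u + h⁻¹ • extCov Γ S)⁻¹ (toEuclideanLin (covPU G u) v)) := by
  rw [gain, toEuclideanLin_mul_apply, toEuclideanLin_mul_apply, covUP, real_inner_comm,
    inner_toEuclideanLin_transpose, real_inner_comm]

/-- The mean squared error of predicting `⟨u, v⟩` by `⟨H(u), w⟩` from noisy data, as a quadratic
function of `w`. -/
theorem avg_residual_sq_add (v : EuclideanSpace ℝ (Fin du))
    (w : EuclideanSpace ℝ (Fin dy ⊕ Fin du)) :
    avg (fun i => (inner ℝ (dev u i) v - inner ℝ (dev (fun j => obs G (u j)) i) w) ^ 2)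
        + h⁻¹ * inner ℝ w (toEuclideanLin (extCov Γ S) w)
      = inner ℝ v (toEuclideanLin (covUU u) v) - 2 * inner ℝ w (toEuclideanLin (covPU G u) v)
        + inner ℝ w (toEuclideanLin (covPP G u + h⁻¹ • extCov Γ S) w) := by
  rw [map_add, LinearMap.add_apply, inner_add_right, map_smul, LinearMap.smul_apply,
    inner_smul_right, covUU, covPU, covPP, inner_toEuclideanLin_sampleCov,
    inner_toEuclideanLin_sampleCov, inner_toEuclideanLin_sampleCov, ← avg_const_mul, ← add_assoc,
    ← avg_sub, ← avg_add]
  congr 2; ext i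
  simp only [dev]; ring

/-- Any linear predictor bounds the analysis covariance from above. -/
theorem inner_analysisCov_le (hΓ : Γ.PosDef) (hS : S.PosDef) (hh : 0 < h)
    (v : EuclideanSpace ℝ (Fin du)) (w : EuclideanSpace ℝ (Fin dy ⊕ Fin du)) :
    inner ℝ v (toEuclideanLin (covUU u - gain G Γ S h u * covPU G u) v)
      ≤ avg (fun i => (inner ℝ (dev u i) v - inner ℝ (dev (fun j => obs G (u j)) i) w) ^ 2)
        + h⁻¹ * inner ℝ w (toEuclideanLin (extCov Γ S) w) := by
  rw [avg_residual_sq_add, map_sub, LinearMap.sub_apply, inner_sub_right, inner_gain_mul_covPU]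
  linarith [(posDef_innovation (G := G) (u := u) hΓ hS hh).two_mul_inner_sub_le
    (toEuclideanLin (covPU G u) v) w]

/-- The Kalman predictor attains the analysis covariance. -/
theorem exists_inner_analysisCov_eq (hΓ : Γ.PosDef) (hS : S.PosDef) (hh : 0 < h)
    (v : EuclideanSpace ℝ (Fin du)) :
    ∃ w : EuclideanSpace ℝ (Fin dy ⊕ Fin du),
      inner ℝ v (toEuclideanLin (covUU u - gain G Γ S h u * covPU G u) v)
        = avg (fun i => (inner ℝ (dev u i) v - inner ℝ (dev (fun j => obs G (u j)) i) w) ^ 2)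
          + h⁻¹ * inner ℝ w (toEuclideanLin (extCov Γ S) w) := by
  refine ⟨toEuclideanLin (covPP G u + h⁻¹ • extCov Γ S)⁻¹ (toEuclideanLin (covPU G u) v), ?_⟩
  rw [avg_residual_sq_add, map_sub, LinearMap.sub_apply, inner_sub_right, inner_gain_mul_covPU,
    (posDef_innovation hΓ hS hh).toEuclideanLin_inv_apply,
    real_inner_comm (toEuclideanLin (covPU G u) v)]
  ring

theorem inner_analysisCov_nonneg (hΓ : Γ.PosDef) (hS : S.PosDef) (hh : 0 < h)
    (v : EuclideanSpace ℝ (Fin du)) :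
    0 ≤ inner ℝ v (toEuclideanLin (covUU u - gain G Γ S h u * covPU G u) v) := by
  obtain ⟨w, hw⟩ := exists_inner_analysisCov_eq (G := G) (u := u) hΓ hS hh v
  rw [hw]
  have h1 := (posSemidef_iff_inner.1 (posDef_extCov hΓ hS).posSemidef).2 w
  exact add_nonneg (avg_nonneg fun i => sq_nonneg _) (mul_nonneg (inv_pos.2 hh).le h1)

theorem inner_dev_obs (w : EuclideanSpace ℝ (Fin du)) (i : Fin K) :
    inner ℝ (dev (fun j => obs G (u j)) i) (toLp 2 (Sum.elim (0 : Fin dy → ℝ) w.ofLp))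
      = inner ℝ (dev u i) w := by
  have h : ∀ x, inner ℝ (obs G x) (toLp 2 (Sum.elim (0 : Fin dy → ℝ) w.ofLp))
      = inner ℝ x w := by
    intro x
    simp [PiLp.inner_apply, obs]
  rw [dev, dev, inner_sub_left, inner_sub_left, h, sampleMean_eq_avg, sampleMean_eq_avg,
    real_inner_comm (toLp 2 _) (avg _), real_inner_comm w (avg u), inner_avg, inner_avg]
  congr 2; ext j
  rw [real_inner_comm, h, real_inner_comm]

theorem inner_extCov_elim_zero (w : EuclideanSpace ℝ (Fin du)) :
    inner ℝ (toLp 2 (Sum.elim (0 : Fin dy → ℝ) w.ofLp)) (toEuclideanLin (extCov Γ S)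
      (toLp 2 (Sum.elim (0 : Fin dy → ℝ) w.ofLp))) = inner ℝ w (toEuclideanLin S w) := by
  rw [inner_toEuclideanLin, inner_toEuclideanLin, extCov, fromBlocks_mulVec]
  simp [sumElim_dotProduct_sumElim, Function.comp_def]

/-- Observing `u` itself contracts an upper bound `c S` of the covariance to
`(c⁻¹ + h)⁻¹ S`. -/
theorem inner_analysisCov_le_of_le (hΓ : Γ.PosDef) (hS : S.PosDef) (hh : 0 < h) {c : ℝ}
    (hc : 0 ≤ c)
    (hC : ∀ v, inner ℝ v (toEuclideanLin (covUU u) v) ≤ c * inner ℝ v (toEuclideanLin S v))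
    (v : EuclideanSpace ℝ (Fin du)) :
    inner ℝ v (toEuclideanLin (covUU u - gain G Γ S h u * covPU G u) v)
      ≤ c / (1 + h * c) * inner ℝ v (toEuclideanLin S v) := by
  -- the minimizer of `(1 - θ) ^ 2 * c + θ ^ 2 / h`
  set θ := h * c / (1 + h * c) with hθ
  have hpos : 0 < 1 + h * c := by positivity
  refine (inner_analysisCov_le hΓ hS hh v
    (toLp 2 (Sum.elim (0 : Fin dy → ℝ) (θ • v).ofLp))).trans ?_
  rw [inner_extCov_elim_zero, map_smul, inner_smul_left, inner_smul_right]
  have h1 : avg (fun i => (inner ℝ (dev u i) v - inner ℝ (dev (fun j => obs G (u j)) i)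
      (toLp 2 (Sum.elim (0 : Fin dy → ℝ) (θ • v).ofLp))) ^ 2)
      = (1 - θ) ^ 2 * inner ℝ v (toEuclideanLin (covUU u) v) := by
    rw [covUU, inner_toEuclideanLin_sampleCov, ← avg_const_mul]
    congr 1; ext i
    rw [inner_dev_obs, inner_smul_right]
    simp only [dev]; ring
  rw [h1]
  have h2 := mul_le_mul_of_nonneg_left (hC v) (sq_nonneg (1 - θ))
  have h3 : c / (1 + h * c) = (1 - θ) ^ 2 * c + h⁻¹ * θ ^ 2 := by
    rw [hθ]; field_simp; ring
  rw [h3]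
  simp only [conj_trivial]
  linarith

/-- If the observed deviations are at most `R`, then the analysis step shrinks the covariance by
at most the factor `1 + h R² / σ`. -/
theorem inner_covUU_le_analysisCov (hΓ : Γ.PosDef) (hS : S.PosDef) (hh : 0 < h) {σ R : ℝ}
    (hσ : 0 < σ) (hR : 0 < R)
    (hσ' : ∀ w, σ * ‖w‖ ^ 2 ≤ inner ℝ w (toEuclideanLin (extCov Γ S) w))
    (hdev : ∀ i, ‖dev (fun j => obs G (u j)) i‖ ≤ R) (v : EuclideanSpace ℝ (Fin du)) :
    inner ℝ v (toEuclideanLin (covUU u) v) ≤ (1 + h * (R ^ 2 / σ)) *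
      inner ℝ v (toEuclideanLin (covUU u - gain G Γ S h u * covPU G u) v) := by
  obtain ⟨w, hw⟩ := exists_inner_analysisCov_eq (G := G) (u := u) hΓ hS hh v
  rw [hw, covUU, inner_toEuclideanLin_sampleCov]
  set b := h * (R ^ 2 / σ) with hb
  have hbpos : 0 < b := by positivity
  have hpw : ∀ i, inner ℝ (dev (fun j => obs G (u j)) i) w ^ 2
      ≤ R ^ 2 / σ * inner ℝ w (toEuclideanLin (extCov Γ S) w) := by
    intro i
    have h1 : inner ℝ (dev (fun j => obs G (u j)) i) w ^ 2 ≤ (R * ‖w‖) ^ 2 := by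
      rw [← sq_abs]
      gcongr
      exact (abs_real_inner_le_norm _ _).trans (by gcongr; exact hdev i)
    calc _ ≤ (R * ‖w‖) ^ 2 := h1
      _ = R ^ 2 / σ * (σ * ‖w‖ ^ 2) := by field_simp
      _ ≤ _ := by gcongr; exact hσ' w
  set Y := inner ℝ w (toEuclideanLin (extCov Γ S) w) with hY
  -- weighted `(x - y + y) ^ 2 ≤ (1 + b) (x - y) ^ 2 + (1 + b⁻¹) y ^ 2`
  have hpt : ∀ i, inner ℝ (dev u i) v * inner ℝ (dev u i) v
      ≤ (1 + b) * (inner ℝ (dev u i) v - inner ℝ (dev (fun j => obs G (u j)) i) w) ^ 2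
        + (1 + b⁻¹) * (R ^ 2 / σ * Y) := by
    intro i
    have h1 := hpw i
    generalize inner ℝ (dev u i) v = x at *
    generalize inner ℝ (dev (fun j => obs G (u j)) i) w = z at *
    have h2 : (1 + b⁻¹) * z ^ 2 ≤ (1 + b⁻¹) * (R ^ 2 / σ * Y) := by gcongr
    have h3 : 0 ≤ (b * (x - z) - z) ^ 2 * b⁻¹ := by positivity
    have h4 : (b * (x - z) - z) ^ 2 * b⁻¹ = b * (x - z) ^ 2 - 2 * (x - z) * z + b⁻¹ * z ^ 2 := by
      field_simp
      ring
    nlinarith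
  have hYnn : 0 ≤ Y := (mul_nonneg hσ.le (sq_nonneg _)).trans (hσ' w)
  have havg : avg (fun _ : Fin K => (1 + b⁻¹) * (R ^ 2 / σ * Y)) ≤ (1 + b⁻¹) * (R ^ 2 / σ * Y) := by
    refine (Real.le_norm_self _).trans (norm_avg_le (by positivity) fun i => ?_)
    rw [Real.norm_of_nonneg (by positivity)]
  have h5 := avg_mono hpt
  rw [avg_add, avg_const_mul] at h5
  have h6 : (1 + b⁻¹) * (R ^ 2 / σ * Y) = (1 + b) * (h⁻¹ * Y) := by
    rw [hb]; field_simp; ring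
  rw [mul_add, ← h6]
  exact h5.trans (add_le_add_right havg _)

theorem norm_dev_obs_le {M ρ : ℝ} (hM : 0 ≤ M) (hρ : 0 ≤ ρ)
    (hL : ∀ x x', ‖obs G x' - obs G x‖ ≤ M * ‖x' - x‖) (hdev : ∀ i, ‖dev u i‖ ≤ ρ) (i : Fin K) :
    ‖dev (fun j => obs G (u j)) i‖ ≤ 2 * M * ρ := by
  have h1 : ∀ j, ‖obs G (u j) - obs G (sampleMean u)‖ ≤ M * ρ := fun j =>
    (hL _ _).trans (by gcongr; exact hdev j)
  have h2 : dev (fun j => obs G (u j)) i = (obs G (u i) - obs G (sampleMean u))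
      - avg fun j => obs G (u j) - obs G (sampleMean u) := by
    rw [avg_sub, avg_const (Fin.pos i), dev, sampleMean_eq_avg]; abel
  rw [h2]
  calc _ ≤ M * ρ + M * ρ := norm_sub_le_of_le (h1 i) (norm_avg_le (by positivity) h1)
    _ = 2 * M * ρ := by ring

end Step

/-! ### Two-sided bounds of the covariance along a run -/

theorem rpow_sub_one_le_one {γ : ℝ} (hγ : γ < 1) {n : ℕ} (hn : 1 ≤ n) :
    (n : ℝ) ^ (γ - 1) ≤ 1 :=
  Real.rpow_le_one_of_one_le_of_nonpos (by exact_mod_cast hn) (by linarith)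

theorem rpow_succ_le {p : ℝ} (hp : p ≤ 0) {n : ℕ} (hn : 1 ≤ n) :
    ((n + 1 : ℕ) : ℝ) ^ p ≤ (n : ℝ) ^ p :=
  Real.rpow_le_rpow_of_nonpos (by exact_mod_cast hn) (by push_cast; linarith) hp

/-- The inequality `n⁻ᵖ (1 + p / n)⁻¹ ≤ (n + 1)⁻ᵖ`. -/
theorem rpow_neg_le_mul_rpow_neg_succ {p : ℝ} (hp₀ : 0 ≤ p) (hp₁ : p ≤ 1) {n : ℕ} (hn : 1 ≤ n) :
    (n : ℝ) ^ (-p) ≤ (1 + p / n) * ((n + 1 : ℕ) : ℝ) ^ (-p) := by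
  have hn' : (0 : ℝ) < n := by exact_mod_cast hn
  have h1 : ((n + 1 : ℕ) : ℝ) = n * (1 + 1 / n) := by push_cast; field_simp
  have h2 : (1 + 1 / (n : ℝ)) ^ p ≤ 1 + p * (1 / n) :=
    rpow_one_add_le_one_add_mul_self (by have : 0 < 1 / (n : ℝ) := by positivity
                                         linarith) hp₀ hp₁
  have h3 : 0 < (1 + 1 / (n : ℝ)) ^ p := by positivity
  rw [h1, Real.mul_rpow hn'.le (by positivity),
    Real.rpow_neg (x := 1 + 1 / (n : ℝ)) (by positivity)]
  have h4 : 1 ≤ (1 + p / n) * ((1 + 1 / (n : ℝ)) ^ p)⁻¹ := by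
    rw [le_mul_inv_iff₀ h3]
    calc _ ≤ 1 + p * (1 / n) := by rw [one_mul]; exact h2
      _ = _ := by ring
  have h5 : 0 < (n : ℝ) ^ (-p) := by positivity
  nlinarith

theorem inv_natCast_le_rpow {γ : ℝ} (hγ : 0 ≤ γ) {n : ℕ} (hn : 1 ≤ n) :
    1 / (n : ℝ) ≤ (n : ℝ) ^ (γ - 1) := by
  rw [one_div, ← Real.rpow_neg_one]
  exact Real.rpow_le_rpow_of_exponent_le (by exact_mod_cast hn) (by linarith)

theorem mul_rpow_mul_rpow (h₀ β γ : ℝ) {n : ℕ} (hn : 1 ≤ n) :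
    h₀ * (n : ℝ) ^ β * (n : ℝ) ^ (γ - β - 1) = h₀ * (n : ℝ) ^ (γ - 1) := by
  rw [mul_assoc, ← Real.rpow_add (by exact_mod_cast hn)]
  congr 2; ring

theorem rpow_half_sq (p : ℝ) (n : ℕ) : ((n : ℝ) ^ (p / 2)) ^ 2 = (n : ℝ) ^ p := by
  rw [← Real.rpow_natCast, ← Real.rpow_mul (Nat.cast_nonneg n)]; congr 1; push_cast; ring

section Run

variable {du dy K : ℕ} {G : EuclideanSpace ℝ (Fin du) → EuclideanSpace ℝ (Fin dy)}
  {y : EuclideanSpace ℝ (Fin dy)}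
  {Γ : Matrix (Fin dy) (Fin dy) ℝ} {S : Matrix (Fin du) (Fin du) ℝ} {h₀ α₀ β γ : ℝ}
  {h a : ℕ → ℝ} {u : ℕ → Fin K → EuclideanSpace ℝ (Fin du)}

theorem covLowerBound_iff (hS : S.PosDef) {κ : ℝ} : CovLowerBound S β γ u κ ↔
    ∀ n : ℕ, 1 ≤ n → ∀ v, κ * (n : ℝ) ^ (γ - β - 1) * inner ℝ v (toEuclideanLin S v)
      ≤ inner ℝ v (toEuclideanLin (covUU (u n)) v) := by
  refine forall₂_congr fun n _ => ?_
  rw [posSemidef_iff_inner, and_iff_right]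
  · simp [inner_sub_right, inner_smul_right]
  · exact (posSemidef_sampleCov _).isHermitian.sub (hS.isHermitian.smul (IsSelfAdjoint.all _))

theorem covUpperBound_iff (hS : S.PosDef) {κ : ℝ} : CovUpperBound S β γ u κ ↔
    ∀ n : ℕ, 1 ≤ n → ∀ v, inner ℝ v (toEuclideanLin (covUU (u n)) v)
      ≤ κ * (n : ℝ) ^ (γ - β - 1) * inner ℝ v (toEuclideanLin S v) := by
  refine forall₂_congr fun n _ => ?_
  rw [posSemidef_iff_inner, and_iff_right]
  · simp [inner_sub_right, inner_smul_right]
  · exact (hS.isHermitian.smul (IsSelfAdjoint.all _)).sub (posSemidef_sampleCov _).isHermitian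

theorem IsEKI.inner_covUU_succ (hu : IsEKI G y Γ S h a u) (n : ℕ)
    (v : EuclideanSpace ℝ (Fin du)) :
    inner ℝ v (toEuclideanLin (covUU (u (n + 1))) v)
      = inner ℝ v (toEuclideanLin (covUU (u n) - gain G Γ S (h n) (u n) * covPU G (u n)) v)
        + a n * inner ℝ v (toEuclideanLin S v) := by
  rw [hu.cov_update n, map_add, LinearMap.add_apply, inner_add_right, map_smul,
    LinearMap.smul_apply, inner_smul_right]

/-- For `k = h₀ κ` and `t = n ^ (γ - 1)`, this bounds the image of `c = κ n ^ (γ - β - 1)` under the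
recursion `c ↦ c / (1 + h c) + a`, relative to `c`. -/
theorem upper_recursion {k A t : ℝ} (hA : 0 ≤ A) (hk : 2 ≤ k) (hkA : 6 * A ≤ k) (ht : 0 < t)
    (ht₁ : t ≤ 1) : 1 / (1 + k * t) + A / k * t ≤ 1 / (1 + t) := by
  have hk0 : 0 < k := by linarith
  have h1 : 1 / (1 + t) - 1 / (1 + k * t) = (k - 1) / ((1 + t) * (1 + k * t)) * t := by
    field_simp; ring
  have h2 : A / k ≤ (k - 1) / ((1 + t) * (1 + k * t)) := by
    rw [div_le_div_iff₀ hk0 (by positivity)]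
    have h3 : (1 + t) * (1 + k * t) ≤ 2 * (1 + k) := by
      apply mul_le_mul <;> nlinarith
    calc _ ≤ A * (2 * (1 + k)) := by gcongr
      _ ≤ k / 6 * (2 * (1 + k)) := by gcongr; linarith
      _ ≤ _ := by nlinarith
  nlinarith [mul_le_mul_of_nonneg_right h2 ht.le]

theorem exists_covUpperBound (hΓ : Γ.PosDef) (hS : S.PosDef)
    (hh₀ : 0 < h₀) (hβγ : γ - 1 ≤ β) (hβγ' : β ≤ γ) (hγ₀ : 0 ≤ γ) (hγ₁ : γ < 1)
    (hpos : ∀ n, 0 < h n) (hh : ∀ n : ℕ, 1 ≤ n → h n = h₀ * (n : ℝ) ^ β)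
    (ha : ∀ n : ℕ, 1 ≤ n → a n = α₀ ^ 2 * h₀⁻¹ * (n : ℝ) ^ (2 * γ - β - 2))
    (hu : IsEKI G y Γ S h a u) : ∃ κ : ℝ, 0 < κ ∧ CovUpperBound S β γ u κ := by
  obtain ⟨σ, hσ, hSσ⟩ := hS.exists_pos_le_inner
  obtain ⟨L, hL, hCL⟩ := exists_norm_toEuclideanLin_le (covUU (u 1))
  set κ := max (max (2 / h₀) (6 * α₀ ^ 2 / h₀)) (L / σ) with hκ
  have hκ1 : 2 ≤ h₀ * κ := by
    have : 2 / h₀ ≤ κ := (le_max_left _ _).trans (le_max_left _ _)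
    rw [div_le_iff₀ hh₀] at this; linarith
  have hκ2 : 6 * α₀ ^ 2 ≤ h₀ * κ := by
    have : 6 * α₀ ^ 2 / h₀ ≤ κ := (le_max_right _ _).trans (le_max_left _ _)
    rw [div_le_iff₀ hh₀] at this; linarith
  have hκ0 : 0 < κ := lt_of_lt_of_le (by positivity) (le_max_right _ _)
  refine ⟨κ, hκ0, (covUpperBound_iff hS).2 fun n hn => ?_⟩
  induction n, hn using Nat.le_induction with
  | base =>
    intro v
    calc inner ℝ v (toEuclideanLin (covUU (u 1)) v)
        ≤ ‖v‖ * (L * ‖v‖) := (real_inner_le_norm _ _).trans (by gcongr; exact hCL v)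
      _ = L / σ * (σ * ‖v‖ ^ 2) := by field_simp
      _ ≤ κ * inner ℝ v (toEuclideanLin S v) := by
        gcongr
        · exact le_max_right _ _
        · exact hSσ v
      _ = _ := by simp
  | succ n hn ih =>
    intro v
    have hn' : (0 : ℝ) < n := by exact_mod_cast hn
    set τ := (n : ℝ) ^ (γ - β - 1) with hτ
    set t := (n : ℝ) ^ (γ - 1) with ht
    have hτ0 : 0 < τ := by positivity
    have ht0 : 0 < t := by positivity
    have hhτ : h n * τ = h₀ * t := by rw [hh n hn, mul_rpow_mul_rpow h₀ β γ hn]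
    have haτ : a n = α₀ ^ 2 * h₀⁻¹ * (τ * t) := by
      rw [ha n hn, hτ, ht, ← Real.rpow_add hn']; congr 2; ring
    have h1 := inner_analysisCov_le_of_le (G := G) hΓ hS (hpos n) (by positivity) ih v
    rw [hu.inner_covUU_succ]
    refine (add_le_add_left h1 _).trans ?_
    rw [← add_mul]
    have hSv := (mul_nonneg hσ.le (sq_nonneg _)).trans (hSσ v)
    refine mul_le_mul_of_nonneg_right ?_ hSv
    have h2 := upper_recursion (sq_nonneg α₀) hκ1 hκ2 ht0 (rpow_sub_one_le_one hγ₁ hn)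
    have h3 : τ ≤ (1 + t) * ((n + 1 : ℕ) : ℝ) ^ (γ - β - 1) := by
      have h4 := rpow_neg_le_mul_rpow_neg_succ (p := 1 + β - γ) (by linarith) (by linarith) hn
      rw [show -(1 + β - γ) = γ - β - 1 by ring] at h4
      refine h4.trans ?_
      gcongr
      refine le_trans ?_ (inv_natCast_le_rpow hγ₀ hn)
      gcongr; linarith
    have h5 : κ * τ / (1 + h n * (κ * τ)) + a n
        = κ * τ * (1 / (1 + h₀ * κ * t) + α₀ ^ 2 / (h₀ * κ) * t) := by
      rw [show h n * (κ * τ) = h₀ * κ * t by linear_combination κ * hhτ, haτ]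
      field_simp
    rw [h5]
    calc _ ≤ κ * τ * (1 / (1 + t)) := by gcongr
      _ ≤ κ * ((1 + t) * ((n + 1 : ℕ) : ℝ) ^ (γ - β - 1)) * (1 / (1 + t)) := by gcongr
      _ = _ := by field_simp

/-- The ensemble shrinks at the rate of the square root of its covariance. -/
theorem exists_norm_dev_le (hS : S.PosDef) {κ : ℝ} (hκ : 0 < κ) (hub : CovUpperBound S β γ u κ) :
    ∃ r : ℝ, 0 < r ∧ ∀ n : ℕ, 1 ≤ n → ∀ i,
      ‖dev (u n) i‖ ≤ r * (n : ℝ) ^ ((γ - β - 1) / 2) := by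
  have htr : 0 ≤ S.trace := hS.posSemidef.trace_nonneg
  refine ⟨Real.sqrt (K * κ * S.trace + 1), by positivity, fun n hn i => ?_⟩
  have h1 : (covUU (u n)).trace ≤ κ * (n : ℝ) ^ (γ - β - 1) * S.trace := by
    have := (hub n hn).trace_nonneg
    rw [trace_sub, trace_smul, smul_eq_mul] at this
    linarith
  refine (sq_le_sq₀ (norm_nonneg _) (by positivity)).1 ?_
  rw [mul_pow, Real.sq_sqrt (by positivity), rpow_half_sq]
  calc _ ≤ K * (covUU (u n)).trace := norm_sub_sampleMean_sq_le (u n) i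
    _ ≤ K * (κ * (n : ℝ) ^ (γ - β - 1) * S.trace) := by gcongr
    _ = K * κ * S.trace * (n : ℝ) ^ (γ - β - 1) := by ring
    _ ≤ _ := by gcongr; linarith

/-- The covariance loses at most the factor `1 + B n ^ (γ - 1)` in one step, even without the
inflation `a n • S`. -/
theorem exists_inner_covUU_le (hΓ : Γ.PosDef) (hS : S.PosDef) (hh₀ : 0 < h₀) {M : ℝ} (hM : 0 < M)
    (hL : ∀ x x', ‖obs G x' - obs G x‖ ≤ M * ‖x' - x‖)
    (hpos : ∀ n, 0 < h n) (hh : ∀ n : ℕ, 1 ≤ n → h n = h₀ * (n : ℝ) ^ β)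
    (hu : IsEKI G y Γ S h a u) {κ : ℝ} (hκ : 0 < κ) (hub : CovUpperBound S β γ u κ) :
    ∃ B : ℝ, 0 < B ∧ ∀ n : ℕ, 1 ≤ n → ∀ v, inner ℝ v (toEuclideanLin (covUU (u n)) v)
      ≤ (1 + B * (n : ℝ) ^ (γ - 1)) * (inner ℝ v (toEuclideanLin (covUU (u (n + 1))) v)
        - a n * inner ℝ v (toEuclideanLin S v)) := by
  obtain ⟨σ, hσ, hσ'⟩ := (posDef_extCov hΓ hS).exists_pos_le_inner
  obtain ⟨r, hr, hdev⟩ := exists_norm_dev_le hS hκ hub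
  refine ⟨h₀ * (2 * M * r) ^ 2 / σ, by positivity, fun n hn v => ?_⟩
  have h1 := norm_dev_obs_le (G := G) hM.le (by positivity) hL (hdev n hn)
  have h2 := inner_covUU_le_analysisCov hΓ hS (hpos n) hσ (by positivity) hσ' h1 v
  rw [hu.inner_covUU_succ, add_sub_cancel_right]
  refine h2.trans_eq ?_
  congr 2
  rw [hh n hn, mul_pow, mul_pow r, rpow_half_sq, mul_pow (2 * M) r]
  linear_combination (2 * M) ^ 2 * r ^ 2 / σ * mul_rpow_mul_rpow h₀ β γ hn

theorem exists_covLowerBound (hΓ : Γ.PosDef) (hS : S.PosDef) (hh₀ : 0 < h₀) (hα₀ : 0 < α₀)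
    (hβγ : γ - 1 ≤ β) (hpos : ∀ n, 0 < h n) (apos : ∀ n, 0 < a n)
    (ha : ∀ n : ℕ, 1 ≤ n → a n = α₀ ^ 2 * h₀⁻¹ * (n : ℝ) ^ (2 * γ - β - 2))
    (hu : IsEKI G y Γ S h a u) {B : ℝ} (hB : 0 < B)
    (hratio : ∀ n : ℕ, 1 ≤ n → ∀ v, inner ℝ v (toEuclideanLin (covUU (u n)) v)
      ≤ (1 + B * (n : ℝ) ^ (γ - 1)) * (inner ℝ v (toEuclideanLin (covUU (u (n + 1))) v)
        - a n * inner ℝ v (toEuclideanLin S v))) :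
    ∃ κ : ℝ, 0 < κ ∧ CovLowerBound S β γ u κ := by
  obtain ⟨σ, hσ, hSσ⟩ := hS.exists_pos_le_inner
  -- small enough for `C₁`, and for the inflation to compensate the loss of one step
  set κ := min (a 0) (α₀ ^ 2 * h₀⁻¹ / B) with hκ
  have hκ0 : 0 < κ := lt_min (apos 0) (by positivity)
  have hκ1 : B * κ ≤ α₀ ^ 2 * h₀⁻¹ := by
    have : κ ≤ α₀ ^ 2 * h₀⁻¹ / B := min_le_right _ _
    rw [le_div_iff₀ hB] at this; linarith
  refine ⟨κ, hκ0, (covLowerBound_iff hS).2 fun n hn => ?_⟩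
  induction n, hn using Nat.le_induction with
  | base =>
    intro v
    have hSv := (mul_nonneg hσ.le (sq_nonneg _)).trans (hSσ v)
    have h1 := inner_analysisCov_nonneg (G := G) (u := u 0) hΓ hS (hpos 0) v
    have h2 := hu.inner_covUU_succ 0 v
    rw [zero_add] at h2
    rw [h2]
    have h3 : κ * inner ℝ v (toEuclideanLin S v) ≤ a 0 * inner ℝ v (toEuclideanLin S v) := by
      gcongr; exact min_le_left _ _
    rw [Nat.cast_one, Real.one_rpow, mul_one]
    linarith
  | succ n hn ih =>
    intro v
    have hn' : (0 : ℝ) < n := by exact_mod_cast hn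
    have hSv := (mul_nonneg hσ.le (sq_nonneg _)).trans (hSσ v)
    have h1 := (ih v).trans (hratio n hn v)
    set τ := (n : ℝ) ^ (γ - β - 1) with hτ
    set t := (n : ℝ) ^ (γ - 1) with ht
    have hτ0 : 0 < τ := by positivity
    have ht0 : 0 < t := by positivity
    have haτ : a n = α₀ ^ 2 * h₀⁻¹ * (τ * t) := by
      rw [ha n hn, hτ, ht, ← Real.rpow_add hn']; congr 2; ring
    have h2 : κ * ((n + 1 : ℕ) : ℝ) ^ (γ - β - 1) * inner ℝ v (toEuclideanLin S v)
        ≤ κ * τ * inner ℝ v (toEuclideanLin S v) := by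
      gcongr; exact rpow_succ_le (by linarith) hn
    refine h2.trans ?_
    set s := inner ℝ v (toEuclideanLin S v)
    set x := inner ℝ v (toEuclideanLin (covUU (u (n + 1))) v)
    have h3 : B * κ * (τ * t * s) ≤ α₀ ^ 2 * h₀⁻¹ * (τ * t * s) := by gcongr
    have h4 : κ * τ * s ≤ (1 + B * t) * (x - B * κ * (τ * t * s)) := by
      refine h1.trans ?_
      refine mul_le_mul_of_nonneg_left ?_ (by positivity)
      rw [haτ]; linarith
    have h5 : (1 + B * t) * (κ * τ * s) ≤ (1 + B * t) * x := by
      have h6 : 0 ≤ B * t * (B * κ * (τ * t * s)) := by positivity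
      nlinarith
    exact le_of_mul_le_mul_left h5 (by positivity)

end Run

/-! ### Strongly convex functions -/

section Convex

variable {E : Type*} [NormedAddCommGroup E] [InnerProductSpace ℝ E] [CompleteSpace E]
  {f : E → ℝ} {c : ℝ}

theorem StronglyConvexWith.add_inner_le (hf : StronglyConvexWith f c) (hc : 0 < c) (x y : E) :
    f y + inner ℝ (gradient f y) (x - y) ≤ f x := by
  have h1 := hf x y
  have h2 : 0 ≤ c * ‖x - y‖ ^ 2 := by positivity
  linarith

theorem StronglyConvexWith.apply_add_smul_le (hf : StronglyConvexWith f c) (hc : 0 < c) (x y : E)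
    {θ : ℝ} (hθ₀ : 0 ≤ θ) (hθ₁ : θ ≤ 1) : f (x + θ • (y - x)) ≤ (1 - θ) * f x + θ * f y := by
  set z := x + θ • (y - x) with hz
  have h1 := hf.add_inner_le hc x z
  have h2 := hf.add_inner_le hc y z
  have h3 : (1 - θ) • (x - z) + θ • (y - z) = 0 := by rw [hz]; module
  have h4 : (1 - θ) * inner ℝ (gradient f z) (x - z) + θ * inner ℝ (gradient f z) (y - z) = 0 := by
    rw [← inner_smul_right, ← inner_smul_right, ← inner_add_right, h3, inner_zero_right]
  nlinarith [mul_le_mul_of_nonneg_left h1 (sub_nonneg.2 hθ₁), mul_le_mul_of_nonneg_left h2 hθ₀]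

theorem StronglyConvexWith.sub_le_norm_gradient_sq (hf : StronglyConvexWith f c) (hc : 0 < c)
    (x y : E) : 4 * c * (f y - f x) ≤ ‖gradient f y‖ ^ 2 := by
  have h1 := hf x y
  have h2 := (abs_le.1 (abs_real_inner_le_norm (gradient f y) (x - y))).1
  nlinarith [sq_nonneg (‖gradient f y‖ - 2 * c * ‖x - y‖)]

variable [FiniteDimensional ℝ E]

theorem StronglyConvexWith.exists_forall_le_of_le (hf : StronglyConvexWith f c) (hc : 0 < c)
    {φ : E → ℝ} (hφ : Continuous φ) (hle : ∀ x, f x ≤ φ x) : ∃ w, ∀ w', φ w ≤ φ w' := by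
  refine hφ.exists_forall_le ?_
  have h1 : Tendsto (fun r : ℝ => f 0 + r * (c * r + -‖gradient f 0‖)) atTop atTop := by
    refine tendsto_atTop_add_const_left _ _ (tendsto_id.atTop_mul_atTop₀ ?_)
    exact tendsto_atTop_add_const_right _ _ (tendsto_id.const_mul_atTop hc)
  refine tendsto_atTop_mono (fun x => ?_) (h1.comp (tendsto_norm_cocompact_atTop (E := E)))
  have h2 := hf x 0
  have h3 := (abs_le.1 (abs_real_inner_le_norm (gradient f 0) (x - 0))).1
  rw [sub_zero] at h2 h3
  have h4 := hle x
  simp only [Function.comp_apply]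
  nlinarith

theorem StronglyConvexWith.exists_minimizer (hf : StronglyConvexWith f c) (hc : 0 < c)
    (hcont : Continuous f) : ∃ w, ∀ x, c * ‖x - w‖ ^ 2 ≤ f x - f w := by
  obtain ⟨w, hw⟩ := hf.exists_forall_le_of_le hc hcont fun _ => le_rfl
  refine ⟨w, fun x => ?_⟩
  have h1 := hf x w
  have h2 : gradient f w = 0 := by
    rw [gradient, IsLocalMin.fderiv_eq_zero (Eventually.of_forall hw), map_zero]
  rw [h2, inner_zero_left] at h1
  linarith

end Convex

/-! ### Gradient descent with a slowly varying preconditioner -/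

section Descent

variable {E : Type*} [NormedAddCommGroup E] [InnerProductSpace ℝ E] [CompleteSpace E]

/-- Quadratic growth of `f` and linear growth of its gradient and of its curvature in `√f`, as
for `f = ‖F‖²` with `F` of bounded first and second derivative. -/
structure HasQuadraticGrowth (f : E → ℝ) (L : ℝ) : Prop where
  pos : 0 < L
  nonneg : ∀ x, 0 ≤ f x
  growth : ∀ x w, f x ≤ L * (f w + ‖x - w‖ ^ 2)
  gradient_sq_le : ∀ x, ‖gradient f x‖ ^ 2 ≤ L * f x
  taylor : ∀ x d, f (x + d) ≤ f x + inner ℝ (gradient f x) d + L * (1 + √(f x)) * ‖d‖ ^ 2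

/-- From index `n₁` on, `x` is a gradient descent for `f` with steps `t n` and preconditioners
`P n` with inverse `A n`, perturbed by `ω n`. Here `P n` and `A n` are uniformly bounded, and the
metric `A n` grows at most by the factor `1 + R * t n` in one step. -/
structure IsPreconditionedDescent (f : E → ℝ) (x : ℕ → E) (P A : ℕ → E →ₗ[ℝ] E) (ω : ℕ → E)
    (t e : ℕ → ℝ) (η R : ℝ) (n₁ : ℕ) : Prop where
  pos : 0 < R
  rate_pos : 0 < η
  t_mem : ∀ n ≥ n₁, 0 ≤ t n ∧ t n ≤ 1
  e_mem : ∀ n ≥ n₁, 0 ≤ e n ∧ e n ≤ 1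
  step : ∀ n ≥ n₁, x (n + 1) = x n - t n • P n (η • gradient f (x n) + ω n)
  norm_err : ∀ n ≥ n₁, ‖ω n‖ ≤ R * (t n * ‖gradient f (x n)‖ + e n * √(f (x n)))
  norm_P : ∀ n ≥ n₁, ∀ v, ‖P n v‖ ≤ R * ‖v‖
  A_P : ∀ n ≥ n₁, ∀ v, A n (P n v) = v
  A_symm : ∀ n ≥ n₁, ∀ v w, inner ℝ (A n v) w = inner ℝ v (A n w)
  le_A : ∀ n ≥ n₁, ∀ v, ‖v‖ ^ 2 ≤ R * inner ℝ v (A n v)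
  A_le : ∀ n ≥ n₁, ∀ v, inner ℝ v (A n v) ≤ R * ‖v‖ ^ 2
  A_succ : ∀ n ≥ n₁, ∀ v, inner ℝ v (A (n + 1) v) ≤ (1 + R * t n) * inner ℝ v (A n v)

variable {f : E → ℝ} {x : ℕ → E} {P A : ℕ → E →ₗ[ℝ] E} {ω : ℕ → E} {t e : ℕ → ℝ}
  {η R c L : ℝ} {n₁ : ℕ}

namespace IsPreconditionedDescent

theorem inner_A_nonneg (h : IsPreconditionedDescent f x P A ω t e η R n₁) {n : ℕ} (hn : n₁ ≤ n)
    (v : E) : 0 ≤ inner ℝ v (A n v) :=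
  nonneg_of_mul_nonneg_right ((sq_nonneg _).trans (h.le_A n hn v)) h.pos

/-- The distance to a reference point `w`, in the metric of the preconditioner, decreases by
the gap `f (x n) - f w`. -/
theorem inner_A_step_le (h : IsPreconditionedDescent f x P A ω t e η R n₁)
    (hf : StronglyConvexWith f c) (hc : 0 < c) (hL : HasQuadraticGrowth f L) {n : ℕ} (hn : n₁ ≤ n)
    (w : E) {ρ : ℝ} (hρ : 0 ≤ ρ) (hw : ‖x n - w‖ ≤ ρ * √(f (x n))) :
    inner ℝ (x (n + 1) - w) (A n (x (n + 1) - w)) ≤ inner ℝ (x n - w) (A n (x n - w))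
      - 2 * η * t n * (f (x n) - f w)
      + t n * (2 * ρ * R * (t n * √L + e n) + t n * (R * (η * √L + R * (√L + 1)) ^ 2))
        * f (x n) := by
  have hR := h.pos
  have hη := h.rate_pos
  obtain ⟨ht0, ht1⟩ := h.t_mem n hn
  obtain ⟨he0, he1⟩ := h.e_mem n hn
  set g := gradient f (x n) with hg
  set s := √(f (x n)) with hs
  have hs0 : 0 ≤ s := Real.sqrt_nonneg _
  have hss : f (x n) = s ^ 2 := (Real.sq_sqrt (hL.nonneg _)).symm
  set d := x n - w with hd
  set p := η • g + ω n with hp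
  have hgs : ‖g‖ ≤ √L * s := by
    rw [hs, ← Real.sqrt_mul hL.pos.le]
    exact Real.le_sqrt_of_sq_le (hL.gradient_sq_le _)
  have hω : ‖ω n‖ ≤ R * (t n * √L + e n) * s := by
    refine (h.norm_err n hn).trans ?_
    calc _ ≤ R * (t n * (√L * s) + e n * s) := by gcongr
      _ = _ := by ring
  have hpn : ‖p‖ ≤ (η * √L + R * (√L + 1)) * s := by
    calc ‖p‖ ≤ ‖η • g‖ + ‖ω n‖ := norm_add_le _ _
      _ ≤ η * (√L * s) + R * (1 * √L + 1) * s := by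
        rw [norm_smul, Real.norm_of_nonneg hη.le]
        gcongr
        exact hω.trans (by gcongr)
      _ = _ := by ring
  have hx : x (n + 1) - w = d - t n • P n p := by
    rw [h.step n hn]
    change x n - t n • P n p - w = x n - w - t n • P n p
    abel
  have hconv := hf.add_inner_le hc w (x n)
  have h1 : inner ℝ g (w - x n) = - inner ℝ d g := by
    rw [hd, ← neg_sub, inner_neg_right, real_inner_comm]
  have h2 : inner ℝ (d - t n • P n p) (A n (d - t n • P n p))
      = inner ℝ d (A n d) - 2 * t n * inner ℝ d p + t n ^ 2 * inner ℝ (P n p) p := by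
    have h3 : inner ℝ (P n p) (A n d) = inner ℝ d p := by
      rw [← h.A_symm n hn, h.A_P n hn, real_inner_comm]
    rw [map_sub, map_smul, h.A_P n hn, inner_sub_left, inner_sub_right, inner_sub_right,
      inner_smul_left, inner_smul_left, inner_smul_right, inner_smul_right, h3]
    simp only [conj_trivial]; ring
  have h4 : inner ℝ d p = η * inner ℝ d g + inner ℝ d (ω n) := by
    rw [hp, inner_add_right, inner_smul_right]
  have h5 : -(ρ * s * (R * (t n * √L + e n) * s)) ≤ inner ℝ d (ω n) := by
    have := (abs_le.1 (abs_real_inner_le_norm d (ω n))).1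
    have h6 : ‖d‖ * ‖ω n‖ ≤ ρ * s * (R * (t n * √L + e n) * s) := by gcongr
    linarith
  have h7 : inner ℝ (P n p) p ≤ R * ((η * √L + R * (√L + 1)) * s) ^ 2 := by
    calc _ ≤ ‖P n p‖ * ‖p‖ := real_inner_le_norm _ _
      _ ≤ R * ‖p‖ * ‖p‖ := by gcongr; exact h.norm_P n hn p
      _ = R * ‖p‖ ^ 2 := by ring
      _ ≤ _ := by gcongr
  rw [hx, h2, h4]
  rw [h1] at hconv
  have h8 : t n ^ 2 * inner ℝ (P n p) p ≤ t n ^ 2 * (R * ((η * √L + R * (√L + 1)) * s) ^ 2) := by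
    gcongr
  have h9 : 2 * t n * (η * (f (x n) - f w)) ≤ 2 * t n * (η * inner ℝ d g) := by
    gcongr; linarith
  have h10 : 2 * t n * -(ρ * s * (R * (t n * √L + e n) * s)) ≤ 2 * t n * inner ℝ d (ω n) := by
    gcongr
  have h11 : t n * (2 * ρ * R * (t n * √L + e n) + t n * (R * (η * √L + R * (√L + 1)) ^ 2))
      * f (x n) = 2 * t n * (ρ * s * (R * (t n * √L + e n) * s))
        + t n ^ 2 * (R * ((η * √L + R * (√L + 1)) * s) ^ 2) := by
    rw [hss]; ring
  rw [h11]
  linarith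

variable [FiniteDimensional ℝ E]

/-- The values along the iteration stay bounded. The second order Taylor term of `f` is not under
control while `f (x n)` is large, and so `f (x n)` itself need not decrease; the Moreau envelope
`min_w f w + μ ⟨x n - w, A n (x n - w)⟩` does. -/
theorem exists_forall_le (h : IsPreconditionedDescent f x P A ω t e η R n₁)
    (hf : StronglyConvexWith f c) (hc : 0 < c) (hcont : Continuous f)
    (hL : HasQuadraticGrowth f L) (ht : Tendsto t atTop (𝓝 0)) (he : Tendsto e atTop (𝓝 0)) :
    ∃ (F : ℝ) (n₂ : ℕ), 0 < F ∧ n₁ ≤ n₂ ∧ ∀ n ≥ n₂, f (x n) ≤ F := by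
  have hR := h.pos
  have hη := h.rate_pos
  have hLpos := hL.pos
  obtain ⟨xs, hxs⟩ := hf.exists_minimizer hc hcont
  have hfs := hL.nonneg xs
  -- chosen such that the growth of the metric costs at most half of the decrease
  set μ := R / η with hμ
  have hμ0 : 0 < μ := by positivity
  have hmin : ∀ n ≥ n₁, ∃ w, ∀ w', f w + μ * inner ℝ (x n - w) (A n (x n - w))
      ≤ f w' + μ * inner ℝ (x n - w') (A n (x n - w')) := by
    intro n hn
    have hA : Continuous (A n) := (A n).continuous_of_finiteDimensional
    refine hf.exists_forall_le_of_le hc (by fun_prop) fun w => ?_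
    have := mul_nonneg hμ0.le (h.inner_A_nonneg hn (x n - w))
    linarith
  choose! w hw using hmin
  set θ := min 1 (c / (2 * (μ * R))) with hθ
  have hθ0 : 0 < θ := lt_min one_pos (by positivity)
  have hθ1 : θ ≤ 1 := min_le_left _ _
  have hθc : μ * R * θ ≤ c / 2 := by
    have : θ ≤ c / (2 * (μ * R)) := min_le_right _ _
    rw [le_div_iff₀ (by positivity)] at this; linarith
  set Q : ℕ → ℝ := fun n => inner ℝ (x n - w n) (A n (x n - w n)) with hQ
  set Φ : ℕ → ℝ := fun n => f (w n) + μ * Q n with hΦ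
  have hQ0 : ∀ n ≥ n₁, 0 ≤ Q n := fun n hn => h.inner_A_nonneg hn _
  have hΦle : ∀ n ≥ n₁, Φ n ≤ f (x n) := fun n hn => by
    have h1 := hw n hn (x n)
    rwa [sub_self, inner_zero_left, mul_zero, add_zero] at h1
  -- comparison with a point between `x n` and the minimizer
  have hgap : ∀ n ≥ n₁, θ / 2 * (f (x n) - f xs) ≤ f (x n) - f (w n) := by
    intro n hn
    have h1 := hw n hn (x n + θ • (xs - x n))
    have h2 := hf.apply_add_smul_le hc (x n) xs hθ0.le hθ1
    have h3 : x n - (x n + θ • (xs - x n)) = θ • (x n - xs) := by module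
    rw [h3, map_smul, inner_smul_left, inner_smul_right] at h1
    simp only [conj_trivial] at h1
    have h4 : μ * (θ * (θ * inner ℝ (x n - xs) (A n (x n - xs)))) ≤ θ / 2 * (f (x n) - f xs) := by
      calc _ ≤ μ * (θ * (θ * (R * ‖x n - xs‖ ^ 2))) := by gcongr; exact h.A_le n hn _
        _ = θ * (μ * R * θ * ‖x n - xs‖ ^ 2) := by ring
        _ ≤ θ * (c / 2 * ‖x n - xs‖ ^ 2) := by gcongr
        _ = θ / 2 * (c * ‖x n - xs‖ ^ 2) := by ring
        _ ≤ _ := by gcongr; exact hxs _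
    have h5 := mul_nonneg hμ0.le (hQ0 n hn)
    simp only [hQ] at h5
    linarith
  have hdist : ∀ n ≥ n₁, ‖x n - w n‖ ≤ √(R / μ) * √(f (x n)) := by
    intro n hn
    rw [← Real.sqrt_mul (by positivity)]
    refine Real.le_sqrt_of_sq_le ((h.le_A n hn _).trans ?_)
    rw [div_mul_eq_mul_div, le_div_iff₀ hμ0]
    have h1 := hΦle n hn
    have h2 := hL.nonneg (w n)
    have h3 : μ * Q n ≤ f (x n) := by simp only [hΦ] at h1; linarith
    calc _ = R * (μ * Q n) := by simp only [hQ]; ring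
      _ ≤ _ := by gcongr
  set ε : ℕ → ℝ := fun n => 2 * √(R / μ) * R * (t n * √L + e n)
    + t n * (R * (η * √L + R * (√L + 1)) ^ 2) with hε
  have hε_lim : Tendsto (fun n => (1 + R) * ε n) atTop (𝓝 0) := by
    have := (((ht.mul_const (√L)).add he).const_mul (2 * √(R / μ) * R)).add
      (ht.mul_const (R * (η * √L + R * (√L + 1)) ^ 2)) |>.const_mul (1 + R)
    simpa using this
  have hsmall : ∀ᶠ n in atTop, (1 + R) * ε n ≤ η * θ / 4 :=
    (hε_lim.eventually_lt_const (show 0 < η * θ / 4 by positivity)).mono fun n hn => hn.le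
  obtain ⟨n₂, hn₂⟩ := eventually_atTop.1 (hsmall.and (eventually_ge_atTop n₁))
  have hn₁₂ : n₁ ≤ n₂ := (hn₂ n₂ le_rfl).2
  have hstep : ∀ n ≥ n₂, Φ (n + 1) ≤ Φ n + μ * (t n * (η * θ / 4 * (2 * f xs - f (x n)))) := by
    intro n hn
    have hn1 : n₁ ≤ n := hn₁₂.trans hn
    obtain ⟨ht0, ht1⟩ := h.t_mem n hn1
    obtain ⟨he0, he1⟩ := h.e_mem n hn1
    have h1 := h.inner_A_step_le hf hc hL hn1 (w n) (Real.sqrt_nonneg _) (hdist n hn1)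
    have h2 := h.A_succ n hn1 (x (n + 1) - w n)
    have h3 := hw (n + 1) (hn1.trans n.le_succ) (w n)
    have h4 := hgap n hn1
    have h5 := hΦle n hn1
    have h6 := hfs.trans (show f xs ≤ f (x n) by
      have := hxs (x n)
      have : 0 ≤ c * ‖x n - xs‖ ^ 2 := by positivity
      linarith)
    set X := f (x n) - f (w n) with hX
    have hX0 : 0 ≤ X := by
      have := mul_nonneg hμ0.le (hQ0 n hn1)
      simp only [hΦ] at h5; linarith
    have hQX : R * Q n ≤ η * X := by
      have : μ * Q n ≤ X := by simp only [hΦ] at h5; linarith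
      calc R * Q n = η * (μ * Q n) := by rw [hμ]; field_simp
        _ ≤ _ := by gcongr
    have hε0 : 0 ≤ ε n := by simp only [hε]; positivity
    have h7 : inner ℝ (x (n + 1) - w n) (A (n + 1) (x (n + 1) - w n))
        ≤ Q n + t n * (η * θ / 4 * (2 * f xs - f (x n))) := by
      calc _ ≤ (1 + R * t n) * (Q n - 2 * η * t n * X + t n * ε n * f (x n)) := by
            refine h2.trans (mul_le_mul_of_nonneg_left h1 (by positivity))
        _ = Q n + t n * (R * Q n) - 2 * η * t n * X - R * t n * (2 * η * t n * X)
            + t n * ((1 + R * t n) * ε n) * f (x n) := by ring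
        _ ≤ Q n + t n * (η * X) - 2 * η * t n * X - 0
            + t n * (η * θ / 4) * f (x n) := by
            have h8 : (1 + R * t n) * ε n ≤ η * θ / 4 := by
              refine le_trans ?_ (hn₂ n hn).1
              gcongr
              nlinarith
            gcongr
            positivity
        _ = Q n - t n * (η * X) + t n * (η * θ / 4) * f (x n) := by ring
        _ ≤ Q n - t n * (η * (θ / 2 * (f (x n) - f xs))) + t n * (η * θ / 4) * f (x n) := by
            gcongr
        _ = _ := by ring
    calc Φ (n + 1) ≤ f (w n) + μ * inner ℝ (x (n + 1) - w n) (A (n + 1) (x (n + 1) - w n)) := h3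
      _ ≤ f (w n) + μ * (Q n + t n * (η * θ / 4 * (2 * f xs - f (x n)))) := by gcongr
      _ = _ := by simp only [hΦ]; ring
  set Φ₀ := max (Φ n₂) (2 * f xs + μ * (1 * (η * θ / 4 * (2 * f xs)))) with hΦ₀
  have hbound : ∀ n ≥ n₂, Φ n ≤ Φ₀ := by
    intro n hn
    induction n, hn using Nat.le_induction with
    | base => exact le_max_left _ _
    | succ n hn ih =>
      obtain ⟨ht0, ht1⟩ := h.t_mem n (hn₁₂.trans hn)
      refine (hstep n hn).trans ?_
      rcases le_total (2 * f xs) (f (x n)) with hcase | hcase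
      · have : μ * (t n * (η * θ / 4 * (2 * f xs - f (x n)))) ≤ 0 :=
          mul_nonpos_of_nonneg_of_nonpos hμ0.le (mul_nonpos_of_nonneg_of_nonpos ht0
            (mul_nonpos_of_nonneg_of_nonpos (by positivity) (by linarith)))
        linarith
      · refine le_trans ?_ (le_max_right _ _)
        have h1 := hΦle n (hn₁₂.trans hn)
        have h2 := hL.nonneg (x n)
        have h3 : t n * (η * θ / 4 * (2 * f xs - f (x n))) ≤ 1 * (η * θ / 4 * (2 * f xs)) := by
          apply mul_le_mul ht1 _ _ zero_le_one
          · gcongr; linarith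
          · exact mul_nonneg (by positivity) (by linarith)
        have h4 := mul_le_mul_of_nonneg_left h3 hμ0.le
        linarith
  refine ⟨max 1 (L * ((1 + R / μ) * Φ₀)), n₂, by positivity, hn₁₂, fun n hn => ?_⟩
  refine le_trans ?_ (le_max_right _ _)
  have hn1 := hn₁₂.trans hn
  have h1 := hL.growth (x n) (w n)
  have h2 := h.le_A n hn1 (x n - w n)
  have h3 := hL.nonneg (w n)
  have h4 := hQ0 n hn1
  calc _ ≤ L * (f (w n) + R * Q n) := h1.trans (by gcongr)
    _ ≤ L * ((1 + R / μ) * Φ n) := by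
      gcongr
      have : (1 + R / μ) * Φ n = f (w n) + R * Q n + (R / μ * f (w n) + μ * Q n) := by
        simp only [hΦ]; field_simp; ring
      rw [this]
      have : 0 ≤ R / μ * f (w n) + μ * Q n := by positivity
      linarith
    _ ≤ _ := by gcongr; exact hbound n hn

/-- Once the values are bounded, the gap to the minimum contracts, up to the perturbation. -/
theorem eventually_gap_le (h : IsPreconditionedDescent f x P A ω t e η R n₁)
    (hf : StronglyConvexWith f c) (hc : 0 < c) (hcont : Continuous f)
    (hL : HasQuadraticGrowth f L) (ht : Tendsto t atTop (𝓝 0)) (he : Tendsto e atTop (𝓝 0))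
    {κ : ℝ} (hκ : 0 < κ) (hP : ∀ n ≥ n₁, ∀ v, κ * ‖v‖ ^ 2 ≤ inner ℝ v (P n v)) (xs : E) :
    ∃ D : ℝ, 0 ≤ D ∧ ∀ᶠ n in atTop, f (x (n + 1)) - f xs
      ≤ (1 - 3 * η * κ * c * t n) * (f (x n) - f xs) + D * (t n * e n) := by
  have hR := h.pos
  have hη := h.rate_pos
  have hLpos := hL.pos
  obtain ⟨F, n₂, hF0, hn₁₂, hF⟩ := h.exists_forall_le hf hc hcont hL ht he
  set C := R ^ 2 + L * (1 + √F) * (R ^ 2 * (2 * η ^ 2 + 4 * R ^ 2)) with hC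
  have hsmall : ∀ᶠ n in atTop, t n * C ≤ η * κ / 4 := by
    have h1 := ht.mul_const C
    rw [zero_mul] at h1
    exact (h1.eventually_lt_const (show 0 < η * κ / 4 by positivity)).mono fun n hn => hn.le
  refine ⟨R ^ 2 * √F * √(L * F) + L * (1 + √F) * (4 * R ^ 4 * F), by positivity, ?_⟩
  filter_upwards [hsmall, eventually_ge_atTop n₂] with n hsm hn
  have hn1 := hn₁₂.trans hn
  obtain ⟨ht0, ht1⟩ := h.t_mem n hn1
  obtain ⟨he0, he1⟩ := h.e_mem n hn1
  set g := gradient f (x n) with hg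
  set p := η • g + ω n with hp
  have hgF : ‖g‖ ≤ √(L * F) :=
    Real.le_sqrt_of_sq_le ((hL.gradient_sq_le _).trans (by gcongr; exact hF n hn))
  have hsF : √(f (x n)) ≤ √F := Real.sqrt_le_sqrt (hF n hn)
  have hω : ‖ω n‖ ≤ R * (t n * ‖g‖ + e n * √F) :=
    (h.norm_err n hn1).trans (by gcongr)
  have hω2 : ‖ω n‖ ^ 2 ≤ 2 * R ^ 2 * (‖g‖ ^ 2 + e n * F) := by
    have h1 : ‖ω n‖ ^ 2 ≤ (R * (t n * ‖g‖ + e n * √F)) ^ 2 := by gcongr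
    have h2 : (t n * ‖g‖ + e n * √F) ^ 2 ≤ 2 * ((t n * ‖g‖) ^ 2 + (e n * √F) ^ 2) := by
      nlinarith [sq_nonneg (t n * ‖g‖ - e n * √F)]
    have h3 : (t n * ‖g‖) ^ 2 ≤ ‖g‖ ^ 2 := by
      gcongr
      exact mul_le_of_le_one_left (norm_nonneg _) ht1
    have h4 : (e n * √F) ^ 2 ≤ e n * F := by
      rw [mul_pow, Real.sq_sqrt hF0.le]
      gcongr; nlinarith
    calc _ ≤ R ^ 2 * (t n * ‖g‖ + e n * √F) ^ 2 := by rw [← mul_pow]; exact h1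
      _ ≤ R ^ 2 * (2 * (‖g‖ ^ 2 + e n * F)) := by
        gcongr
        exact h2.trans (by linarith)
      _ = _ := by ring
  have hp2 : ‖p‖ ^ 2 ≤ (2 * η ^ 2 + 4 * R ^ 2) * ‖g‖ ^ 2 + 4 * R ^ 2 * F * e n := by
    have h1 : ‖p‖ ≤ η * ‖g‖ + ‖ω n‖ := by
      refine (norm_add_le _ _).trans_eq ?_
      rw [norm_smul, Real.norm_of_nonneg hη.le]
    have h2 : ‖p‖ ^ 2 ≤ (η * ‖g‖ + ‖ω n‖) ^ 2 := by gcongr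
    nlinarith [sq_nonneg (η * ‖g‖ - ‖ω n‖)]
  have hstep : x (n + 1) = x n + -(t n • P n p) := by rw [h.step n hn1, sub_eq_add_neg]
  have htay := hL.taylor (x n) (-(t n • P n p))
  rw [← hstep, norm_neg, norm_smul, Real.norm_of_nonneg ht0, inner_neg_right,
    inner_smul_right] at htay
  have h1 : η * κ * ‖g‖ ^ 2 - R ^ 2 * (t n * ‖g‖ ^ 2 + e n * (√F * √(L * F)))
      ≤ inner ℝ g (P n p) := by
    have h2 : inner ℝ g (P n p) = η * inner ℝ g (P n g) + inner ℝ g (P n (ω n)) := by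
      rw [hp, map_add, map_smul, inner_add_right, inner_smul_right]
    have h3 := mul_le_mul_of_nonneg_left (hP n hn1 g) hη.le
    have h4 := (abs_le.1 (abs_real_inner_le_norm g (P n (ω n)))).1
    have h5 : ‖g‖ * ‖P n (ω n)‖ ≤ R ^ 2 * (t n * ‖g‖ ^ 2 + e n * (√F * √(L * F))) := by
      calc _ ≤ ‖g‖ * (R * (R * (t n * ‖g‖ + e n * √F))) := by
            gcongr
            exact (h.norm_P n hn1 _).trans (by gcongr)
        _ = R ^ 2 * (t n * ‖g‖ ^ 2 + e n * (√F * ‖g‖)) := by ring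
        _ ≤ _ := by gcongr
    linarith
  have h2 : (t n * ‖P n p‖) ^ 2
      ≤ t n * (t n * (R ^ 2 * (2 * η ^ 2 + 4 * R ^ 2)) * ‖g‖ ^ 2 + 4 * R ^ 4 * F * e n) := by
    calc _ ≤ (t n * (R * ‖p‖)) ^ 2 := by gcongr; exact h.norm_P n hn1 _
      _ = t n ^ 2 * R ^ 2 * ‖p‖ ^ 2 := by ring
      _ ≤ t n ^ 2 * R ^ 2 * ((2 * η ^ 2 + 4 * R ^ 2) * ‖g‖ ^ 2 + 4 * R ^ 2 * F * e n) := by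
        gcongr
      _ = t n * (t n * (R ^ 2 * (2 * η ^ 2 + 4 * R ^ 2)) * ‖g‖ ^ 2
          + t n * (4 * R ^ 4 * F * e n)) := by ring
      _ ≤ _ := by
        exact mul_le_mul_of_nonneg_left
          (add_le_add le_rfl (mul_le_of_le_one_left (by positivity) ht1)) ht0
  have h3 : L * (1 + √(f (x n))) * (t n * ‖P n p‖) ^ 2 ≤ L * (1 + √F) *
      (t n * (t n * (R ^ 2 * (2 * η ^ 2 + 4 * R ^ 2)) * ‖g‖ ^ 2 + 4 * R ^ 4 * F * e n)) := by
    gcongr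
  have h4 := mul_le_mul_of_nonneg_left h1 ht0
  have h5 : t n * (t n * C * ‖g‖ ^ 2) ≤ t n * (η * κ / 4 * ‖g‖ ^ 2) := by gcongr
  have h6 : 4 * c * (f (x n) - f xs) ≤ ‖g‖ ^ 2 :=
    hf.sub_le_norm_gradient_sq hc xs (x n)
  have h7 : t n * (3 / 4 * (η * κ) * (4 * c * (f (x n) - f xs)))
      ≤ t n * (3 / 4 * (η * κ) * ‖g‖ ^ 2) := by gcongr
  have h8 : L * (1 + √F) *
      (t n * (t n * (R ^ 2 * (2 * η ^ 2 + 4 * R ^ 2)) * ‖g‖ ^ 2 + 4 * R ^ 4 * F * e n))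
      = t n * (t n * C * ‖g‖ ^ 2) - t n * (R ^ 2 * (t n * ‖g‖ ^ 2))
        + L * (1 + √F) * (4 * R ^ 4 * F) * (t n * e n) := by rw [hC]; ring
  linarith

end IsPreconditionedDescent

end Descent

/-! ### Growth of the loss -/

/-- One constant for the first derivative, the Lipschitz bound and the Taylor remainder. -/
theorem HasBoundedDerivs.exists_bound {E F : Type*} [NormedAddCommGroup E] [NormedSpace ℝ E]
    [NormedAddCommGroup F] [NormedSpace ℝ F] {H : E → F} (hH : HasBoundedDerivs H) :
    ∃ M : ℝ, 0 < M ∧ (∀ x, ‖fderiv ℝ H x‖ ≤ M) ∧ (∀ x x', ‖H x' - H x‖ ≤ M * ‖x' - x‖) ∧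
      ∀ x d, ‖H (x + d) - H x - fderiv ℝ H x d‖ ≤ M * ‖d‖ ^ 2 := by
  obtain ⟨hd, hdd, M₁, M₂, h1, h2, h3⟩ := hH
  have hM1 : M₁ ≤ |M₁| + |M₂| + 1 := by linarith [le_abs_self M₁, abs_nonneg M₂]
  have hM2 : M₂ ≤ |M₁| + |M₂| + 1 := by linarith [le_abs_self M₂, abs_nonneg M₁]
  refine ⟨|M₁| + |M₂| + 1, by positivity, fun x => (h1 x).trans hM1,
    fun x x' => (h2 x x').trans (by gcongr), fun x d => ?_⟩
  set M := |M₁| + |M₂| + 1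
  have hline : ∀ s : ℝ, HasDerivAt (fun s : ℝ => x + s • d) d s := fun s => by
    simpa using ((hasDerivAt_id s).smul_const d).const_add x
  have hD1 : ∀ s : ℝ, HasDerivAt (fun s : ℝ => fderiv ℝ H (x + s • d) d)
      (fderiv ℝ (fderiv ℝ H) (x + s • d) d d) s := by
    intro s
    have h4 := (hdd (x + s • d)).hasFDerivAt.comp_hasDerivAt s (hline s)
    exact h4.clm_apply (hasDerivAt_const s d) |>.congr_deriv (by simp)
  have hD0 : ∀ s : ℝ, HasDerivAt (fun s : ℝ => H (x + s • d) - s • fderiv ℝ H x d)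
      (fderiv ℝ H (x + s • d) d - fderiv ℝ H x d) s := by
    intro s
    have h4 := (hd (x + s • d)).hasFDerivAt.comp_hasDerivAt s (hline s)
    exact (h4.sub ((hasDerivAt_id s).smul_const (fderiv ℝ H x d))).congr_deriv (by simp)
  have hb1 : ∀ s ∈ Set.Icc (0 : ℝ) 1,
      ‖fderiv ℝ H (x + s • d) d - fderiv ℝ H x d‖ ≤ M * ‖d‖ ^ 2 := by
    intro s hs
    have h4 := norm_image_sub_le_of_norm_deriv_le_segment' (a := 0) (b := 1)
      (fun s _ => (hD1 s).hasDerivWithinAt)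
      (fun s _ => (h3 (x + s • d) d).trans (mul_le_mul_of_nonneg_right hM2 (sq_nonneg _))) s hs
    simp only [zero_smul, add_zero, sub_zero] at h4
    exact h4.trans (mul_le_of_le_one_right (by positivity) hs.2)
  have h5 := norm_image_sub_le_of_norm_deriv_le_segment_01'
    (fun s _ => (hD0 s).hasDerivWithinAt) (fun s hs => hb1 s ⟨hs.1, hs.2.le⟩)
  simp only [one_smul, zero_smul, add_zero, sub_zero] at h5
  rwa [sub_right_comm] at h5

section Loss

variable {du dy : ℕ} {G : EuclideanSpace ℝ (Fin du) → EuclideanSpace ℝ (Fin dy)}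
  {y : EuclideanSpace ℝ (Fin dy)} {Γ : Matrix (Fin dy) (Fin dy) ℝ}
  {S : Matrix (Fin du) (Fin du) ℝ}

/-- The residual `H(x) - z`. -/
noncomputable def resid (G : EuclideanSpace ℝ (Fin du) → EuclideanSpace ℝ (Fin dy))
    (y : EuclideanSpace ℝ (Fin dy)) (x : EuclideanSpace ℝ (Fin du)) :
    EuclideanSpace ℝ (Fin dy ⊕ Fin du) :=
  obs G x - extData du y

theorem hasFDerivAt_loss (hΓ : Γ.PosDef) (hS : S.PosDef) (hH : Differentiable ℝ (obs G))
    (x : EuclideanSpace ℝ (Fin du)) :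
    HasFDerivAt (loss G y Γ S) ((2 : ℝ) • (innerSL ℝ (toEuclideanLin (extCov Γ S)⁻¹
      (resid G y x))).comp (fderiv ℝ (obs G) x)) x := by
  have h1 : HasFDerivAt (resid G y) (fderiv ℝ (obs G) x) x := (hH x).hasFDerivAt.sub_const _
  have h2 := h1.inner ℝ ((toEuclideanLin (extCov Γ S)⁻¹).toContinuousLinearMap.hasFDerivAt.comp
    x h1)
  have h3 : loss G y Γ S = fun x => inner ℝ (resid G y x)
      (toEuclideanLin (extCov Γ S)⁻¹ (resid G y x)) := funext (loss_eq_inner G y hΓ hS)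
  rw [h3]
  refine h2.congr_fderiv ?_
  ext d
  have h4 := (posDef_extCov hΓ hS).inv.isHermitian.inner_toEuclideanLin_comm (resid G y x)
    (fderiv ℝ (obs G) x d)
  rw [real_inner_comm] at h4
  simp [fderivInnerCLM_apply, real_inner_comm (fderiv ℝ (obs G) x d), ← h4]
  ring

theorem inner_gradient_loss (hΓ : Γ.PosDef) (hS : S.PosDef) (hH : Differentiable ℝ (obs G))
    (x d : EuclideanSpace ℝ (Fin du)) : inner ℝ (gradient (loss G y Γ S) x) d
      = 2 * inner ℝ (toEuclideanLin (extCov Γ S)⁻¹ (resid G y x)) (fderiv ℝ (obs G) x d) := by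
  rw [gradient, InnerProductSpace.toDual_symm_apply, (hasFDerivAt_loss hΓ hS hH x).fderiv]
  simp

theorem exists_norm_resid_le (hΓ : Γ.PosDef) (hS : S.PosDef)
    (G : EuclideanSpace ℝ (Fin du) → EuclideanSpace ℝ (Fin dy)) (y : EuclideanSpace ℝ (Fin dy)) :
    ∃ ν : ℝ, 0 < ν ∧ ∀ x, ‖resid G y x‖ ≤ ν * √(loss G y Γ S x) := by
  obtain ⟨σ, hσ, hσ'⟩ := (posDef_extCov hΓ hS).inv.exists_pos_le_inner
  refine ⟨√σ⁻¹, by positivity, fun x => ?_⟩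
  rw [← Real.sqrt_mul (by positivity)]
  refine Real.le_sqrt_of_sq_le ?_
  rw [le_inv_mul_iff₀ hσ, loss_eq_inner G y hΓ hS]
  exact hσ' _

theorem exists_hasQuadraticGrowth_loss (hΓ : Γ.PosDef) (hS : S.PosDef)
    (hH : HasBoundedDerivs (obs G)) : ∃ L, HasQuadraticGrowth (loss G y Γ S) L := by
  obtain ⟨M, hM, hJ, hLip, hTay⟩ := hH.exists_bound
  obtain ⟨ν, hν, hres⟩ := exists_norm_resid_le hΓ hS G y
  obtain ⟨b, hb, hB⟩ := exists_norm_toEuclideanLin_le (extCov Γ S)⁻¹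
  set f := loss G y Γ S with hf
  set B := toEuclideanLin (extCov Γ S)⁻¹ with hBdef
  have hf_eq : ∀ x, f x = inner ℝ (resid G y x) (B (resid G y x)) := loss_eq_inner G y hΓ hS
  have hf0 : ∀ x, 0 ≤ f x := fun x => by
    rw [hf_eq]
    exact (posSemidef_iff_inner.1 (posDef_extCov hΓ hS).inv.posSemidef).2 _
  have hquad : ∀ w w', |inner ℝ w (B w')| ≤ b * (‖w‖ * ‖w'‖) := fun w w' => by
    refine (abs_real_inner_le_norm _ _).trans ?_
    calc _ ≤ ‖w‖ * (b * ‖w'‖) := by gcongr; exact hB _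
      _ = _ := by ring
  have hres2 : ∀ x, ‖resid G y x‖ ^ 2 ≤ ν ^ 2 * f x := fun x => by
    calc _ ≤ (ν * √(f x)) ^ 2 := by gcongr; exact hres x
      _ = _ := by rw [mul_pow, Real.sq_sqrt (hf0 x)]
  set L := 2 * b * ν ^ 2 + 2 * b * M ^ 2 + (2 * b * M * ν) ^ 2 + 2 * b * ν * M with hL
  refine ⟨L, by positivity, hf0, fun x w => ?_, fun x => ?_, fun x d => ?_⟩
  · have h1 : ‖resid G y x‖ ≤ ‖resid G y w‖ + M * ‖x - w‖ := by
      have h2 : resid G y x = resid G y w + (obs G x - obs G w) := by simp only [resid]; abel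
      rw [h2]
      exact (norm_add_le _ _).trans (by gcongr; exact hLip _ _)
    calc f x ≤ b * (‖resid G y x‖ * ‖resid G y x‖) := by
          rw [hf_eq]; exact (le_abs_self _).trans (hquad _ _)
      _ ≤ b * (2 * (‖resid G y w‖ ^ 2 + M ^ 2 * ‖x - w‖ ^ 2)) := by
          refine mul_le_mul_of_nonneg_left ?_ hb.le
          have h2 : ‖resid G y x‖ ^ 2 ≤ (‖resid G y w‖ + M * ‖x - w‖) ^ 2 := by gcongr
          linarith [sq_nonneg (‖resid G y w‖ - M * ‖x - w‖)]
      _ ≤ b * (2 * (ν ^ 2 * f w + M ^ 2 * ‖x - w‖ ^ 2)) := by gcongr; exact hres2 w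
      _ = 2 * b * ν ^ 2 * f w + 2 * b * M ^ 2 * ‖x - w‖ ^ 2 := by ring
      _ ≤ L * f w + L * ‖x - w‖ ^ 2 := by
          have h3 : 2 * b * ν ^ 2 ≤ L := by
            have : 0 ≤ 2 * b * M ^ 2 + (2 * b * M * ν) ^ 2 + 2 * b * ν * M := by positivity
            linarith
          have h4 : 2 * b * M ^ 2 ≤ L := by
            have : 0 ≤ 2 * b * ν ^ 2 + (2 * b * M * ν) ^ 2 + 2 * b * ν * M := by positivity
            linarith
          have := hf0 w
          gcongr
      _ = _ := by ring
  · set g := gradient f x with hg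
    have h1 : ‖g‖ ^ 2 ≤ 2 * b * M * ‖resid G y x‖ * ‖g‖ := by
      rw [← real_inner_self_eq_norm_sq, hg, hf, inner_gradient_loss hΓ hS hH.1, ← hf, ← hg,
        real_inner_comm]
      have h2 := (le_abs_self _).trans (hquad (fderiv ℝ (obs G) x g) (resid G y x))
      have h3 : ‖fderiv ℝ (obs G) x g‖ ≤ M * ‖g‖ :=
        ((fderiv ℝ (obs G) x).le_opNorm g).trans (by gcongr; exact hJ x)
      calc _ ≤ 2 * (b * (‖fderiv ℝ (obs G) x g‖ * ‖resid G y x‖)) := by gcongr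
        _ ≤ 2 * (b * (M * ‖g‖ * ‖resid G y x‖)) := by gcongr
        _ = _ := by ring
    have h2 : ‖g‖ ≤ 2 * b * M * ‖resid G y x‖ := by
      rcases (norm_nonneg g).eq_or_lt with h3 | h3
      · rw [← h3]; positivity
      · rw [sq] at h1; exact le_of_mul_le_mul_right h1 h3
    calc ‖g‖ ^ 2 ≤ (2 * b * M * ‖resid G y x‖) ^ 2 := by gcongr
      _ = (2 * b * M) ^ 2 * ‖resid G y x‖ ^ 2 := by ring
      _ ≤ (2 * b * M) ^ 2 * (ν ^ 2 * f x) := by gcongr; exact hres2 x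
      _ = (2 * b * M * ν) ^ 2 * f x := by ring
      _ ≤ L * f x := by
          have := hf0 x
          have h3 : (2 * b * M * ν) ^ 2 ≤ L := by
            have : 0 ≤ 2 * b * ν ^ 2 + 2 * b * M ^ 2 + 2 * b * ν * M := by positivity
            linarith
          gcongr
  · set δ := obs G (x + d) - obs G x with hδ
    have h1 : resid G y (x + d) = resid G y x + δ := by simp only [resid, hδ]; abel
    have h2 : inner ℝ δ (B (resid G y x)) = inner ℝ (resid G y x) (B δ) := by
      rw [real_inner_comm, (posDef_extCov hΓ hS).inv.isHermitian.inner_toEuclideanLin_comm]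
    have h3 : f (x + d) = f x + 2 * inner ℝ δ (B (resid G y x)) + inner ℝ δ (B δ) := by
      rw [hf_eq, hf_eq, h1, map_add, inner_add_left, inner_add_right, inner_add_right, h2]; ring
    have h4 : inner ℝ δ (B (resid G y x)) = inner ℝ (fderiv ℝ (obs G) x d) (B (resid G y x))
        + inner ℝ (δ - fderiv ℝ (obs G) x d) (B (resid G y x)) := by
      rw [← inner_add_left]; congr 1; abel
    have h5 : inner ℝ (δ - fderiv ℝ (obs G) x d) (B (resid G y x))
        ≤ b * (M * ‖d‖ ^ 2 * (ν * √(f x))) := by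
      refine (le_abs_self _).trans ((hquad _ _).trans ?_)
      gcongr
      · exact hTay x d
      · exact hres x
    have h6 : inner ℝ δ (B δ) ≤ b * (M * ‖d‖ * (M * ‖d‖)) := by
      have h7 : ‖δ‖ ≤ M * ‖d‖ := by simpa using hLip x (x + d)
      refine (le_abs_self _).trans ((hquad _ _).trans ?_)
      gcongr
    rw [h3, h4, hf, inner_gradient_loss hΓ hS hH.1, ← hf, ← hBdef,
      real_inner_comm (fderiv ℝ (obs G) x d)]
    have h8 : 0 ≤ √(f x) := Real.sqrt_nonneg _
    have h9 : 2 * b * ν * M * (√(f x) * ‖d‖ ^ 2) + b * M ^ 2 * ‖d‖ ^ 2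
        ≤ L * (√(f x) * ‖d‖ ^ 2) + L * ‖d‖ ^ 2 := by
      have h10 : 2 * b * ν * M ≤ L := by
        have : 0 ≤ 2 * b * ν ^ 2 + (2 * b * M * ν) ^ 2 + 2 * b * M ^ 2 := by positivity
        linarith
      have h11 : b * M ^ 2 ≤ L := by
        have : 0 ≤ 2 * b * ν ^ 2 + (2 * b * M * ν) ^ 2 + 2 * b * ν * M + b * M ^ 2 := by
          positivity
        linarith
      gcongr
    linarith

end Loss

/-! ### The mean update as preconditioned gradient descent -/

section MeanStep

variable {du dy K : ℕ} {G : EuclideanSpace ℝ (Fin du) → EuclideanSpace ℝ (Fin dy)}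
  {y : EuclideanSpace ℝ (Fin dy)} {Γ : Matrix (Fin dy) (Fin dy) ℝ}
  {S : Matrix (Fin du) (Fin du) ℝ}

theorem norm_toEuclideanLin_covUU_le {u : Fin K → EuclideanSpace ℝ (Fin du)} {ρ : ℝ}
    (hρ : 0 ≤ ρ) (hdev : ∀ i, ‖dev u i‖ ≤ ρ) (v : EuclideanSpace ℝ (Fin du)) :
    ‖toEuclideanLin (covUU u) v‖ ≤ ρ ^ 2 * ‖v‖ := by
  rw [covUU, toEuclideanLin_sampleCov]
  refine norm_avg_le (by positivity) fun i => ?_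
  rw [norm_smul]
  calc _ ≤ (‖dev u i‖ * ‖v‖) * ‖dev u i‖ := by
        gcongr
        · exact norm_inner_le_norm _ _
        · rfl
    _ ≤ (ρ * ‖v‖) * ρ := by gcongr <;> exact hdev i
    _ = _ := by ring

/-- The Kalman gain applied to the residual. -/
noncomputable def innovation (G : EuclideanSpace ℝ (Fin du) → EuclideanSpace ℝ (Fin dy))
    (y : EuclideanSpace ℝ (Fin dy)) (Γ : Matrix (Fin dy) (Fin dy) ℝ)
    (S : Matrix (Fin du) (Fin du) ℝ) (h : ℝ) (u : Fin K → EuclideanSpace ℝ (Fin du)) :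
    EuclideanSpace ℝ (Fin du) :=
  toEuclideanLin (gain G Γ S h u) (resid G y (sampleMean u))

theorem IsEKI.sampleMean_succ {h a : ℕ → ℝ} {u : ℕ → Fin K → EuclideanSpace ℝ (Fin du)}
    (hu : IsEKI G y Γ S h a u) (n : ℕ) :
    sampleMean (u (n + 1)) = sampleMean (u n) - innovation G y Γ S (h n) (u n) := by
  rw [hu.mean_update n, innovation, sub_eq_add_neg (sampleMean (u n)), ← map_neg, resid, neg_sub,
    toLpLin_apply]

/-- Up to an error of third order in the spread `ρ` of the ensemble, the mean moves by `- C v`,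
where `v` differs from `h / 2 • ∇ℓ` by a second order multiple of `v` itself and a third order error.
With `J` the derivative of the observation map, `v = Jᵀ w` for
`w = (C^{pp} + h⁻¹ Γ₊)⁻¹ (H(m) - z)` of norm `q`, and `h / 2 • ∇ℓ - v = h Jᵀ Γ₊⁻¹ C^{pp} w`
with `C^{pp} w` close to `J C v`. The constant `ν` bounds the residual by the square root of the
loss. -/
theorem exists_innovation_approx (hΓ : Γ.PosDef) (hS : S.PosDef) {M : ℝ} (hM : 0 < M)
    (hd : Differentiable ℝ (obs G)) (hJ : ∀ x, ‖fderiv ℝ (obs G) x‖ ≤ M)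
    (hLip : ∀ x x', ‖obs G x' - obs G x‖ ≤ M * ‖x' - x‖)
    (hTay : ∀ x d, ‖obs G (x + d) - obs G x - fderiv ℝ (obs G) x d‖ ≤ M * ‖d‖ ^ 2)
    {σ b ν : ℝ} (hσ : 0 < σ) (hb : 0 < b)
    (hσ' : ∀ w, σ * ‖w‖ ^ 2 ≤ inner ℝ w (toEuclideanLin (extCov Γ S) w))
    (hB : ∀ w, ‖toEuclideanLin (extCov Γ S)⁻¹ w‖ ≤ b * ‖w‖)
    (hν : ∀ x, ‖resid G y x‖ ≤ ν * √(loss G y Γ S x)) {h : ℝ} (hh : 0 < h)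
    {u : Fin K → EuclideanSpace ℝ (Fin du)} {ρ : ℝ} (hρ : 0 ≤ ρ) (hdev : ∀ i, ‖dev u i‖ ≤ ρ) :
    ∃ (v : EuclideanSpace ℝ (Fin du)) (q : ℝ),
      q ≤ h / σ * (ν * √(loss G y Γ S (sampleMean u))) ∧
      ‖innovation G y Γ S h u - toEuclideanLin (covUU u) v‖ ≤ 2 * M * ρ ^ 3 * q ∧
      ‖(h / 2) • gradient (loss G y Γ S) (sampleMean u) - v‖
        ≤ h * (M * b) * (M * ρ ^ 2 * ‖v‖ + 6 * M ^ 2 * ρ ^ 3 * q) := by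
  set m := sampleMean u with hm
  set J := fderiv ℝ (obs G) m with hJdef
  set r := resid G y m with hr
  set Mat := covPP G u + h⁻¹ • extCov Γ S with hMat
  have hMatPD : Mat.PosDef := posDef_innovation hΓ hS hh
  set q := toEuclideanLin Mat⁻¹ r with hq
  have hMq : toEuclideanLin Mat q = r := hMatPD.toEuclideanLin_inv_apply r
  set v := ContinuousLinearMap.adjoint J q with hv
  have hJd : ∀ d, ‖J d‖ ≤ M * ‖d‖ := fun d => (J.le_opNorm d).trans (by gcongr; exact hJ m)
  have hJa : ∀ w, ‖ContinuousLinearMap.adjoint J w‖ ≤ M * ‖w‖ := fun w =>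
    ((ContinuousLinearMap.adjoint J).le_opNorm w).trans (by
      rw [LinearIsometryEquiv.norm_map]; gcongr; exact hJ m)
  set p : Fin K → EuclideanSpace ℝ (Fin dy ⊕ Fin du) := dev fun j => obs G (u j) with hp
  have hpn : ∀ i, ‖p i‖ ≤ 2 * M * ρ := norm_dev_obs_le hM.le hρ hLip hdev
  have hJdev : ∀ i, ‖J (dev u i)‖ ≤ M * ρ := fun i => (hJd _).trans (by gcongr; exact hdev i)
  -- linearization of the observed deviations
  have hε : ∀ i, ‖p i - J (dev u i)‖ ≤ 2 * M * ρ ^ 2 := by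
    intro i
    have h1 : ∀ j, ‖obs G (u j) - obs G m - J (dev u j)‖ ≤ M * ρ ^ 2 := by
      intro j
      have h2 := hTay m (dev u j)
      have h3 : m + dev u j = u j := by rw [dev, ← hm]; abel
      rw [h3] at h2
      exact h2.trans (by gcongr; exact hdev j)
    have h2 : p i - J (dev u i) = (obs G (u i) - obs G m - J (dev u i))
        - avg fun j => obs G (u j) - obs G m - J (dev u j) := by
      have h3 : avg (fun j => J (dev u j)) = 0 := by
        have := map_avg J.toLinearMap (dev u)
        rw [avg_dev, map_zero] at this
        exact this.symm
      rw [avg_sub, avg_sub, avg_const (Fin.pos i), h3, hp, dev, sampleMean_eq_avg]; abel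
    rw [h2]
    calc _ ≤ M * ρ ^ 2 + M * ρ ^ 2 := norm_sub_le_of_le (h1 i) (norm_avg_le (by positivity) h1)
      _ = _ := by ring
  have hvin : ∀ d, inner ℝ d v = inner ℝ (J d) q := fun d =>
    ContinuousLinearMap.adjoint_inner_right J d q
  refine ⟨v, ‖q‖, ?_, ?_, ?_⟩
  · refine le_trans ?_ (mul_le_mul_of_nonneg_left (hν m) (by positivity))
    have h1 : h⁻¹ * (σ * ‖q‖ ^ 2) ≤ ‖q‖ * ‖r‖ := by
      calc _ ≤ h⁻¹ * inner ℝ q (toEuclideanLin (extCov Γ S) q) := by gcongr; exact hσ' q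
        _ ≤ inner ℝ q (toEuclideanLin Mat q) := by
          rw [hMat, map_add, LinearMap.add_apply, inner_add_right, map_smul, LinearMap.smul_apply,
            inner_smul_right]
          have hnn : 0 ≤ inner ℝ q (toEuclideanLin (covPP G u) q) :=
            (posSemidef_iff_inner.1 (posSemidef_sampleCov fun i => obs G (u i))).2 q
          linarith
        _ ≤ _ := by rw [hMq]; exact real_inner_le_norm _ _
    rcases (norm_nonneg q).eq_or_lt with h2 | h2
    · rw [← h2]; positivity
    · have h3 : σ / h * ‖q‖ ≤ ‖r‖ := by
        refine le_of_mul_le_mul_left ?_ h2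
        calc _ = h⁻¹ * (σ * ‖q‖ ^ 2) := by field_simp
          _ ≤ _ := h1
      calc ‖q‖ = h / σ * (σ / h * ‖q‖) := by field_simp
        _ ≤ _ := by gcongr
  · have h1 : innovation G y Γ S h u = avg fun i => inner ℝ (p i) q • dev u i := by
      rw [innovation, gain, toEuclideanLin_mul_apply, covUP, covPU, sampleCov_transpose,
        toEuclideanLin_sampleCov]
      rfl
    have h2 : toEuclideanLin (covUU u) v = avg fun i => inner ℝ (J (dev u i)) q • dev u i := by
      rw [covUU, toEuclideanLin_sampleCov]
      congr 1; ext1 i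
      rw [← hvin]; rfl
    rw [h1, h2, ← avg_sub]
    refine norm_avg_le (by positivity) fun i => ?_
    rw [← sub_smul, ← inner_sub_left, norm_smul]
    calc _ ≤ (2 * M * ρ ^ 2 * ‖q‖) * ρ := by
          gcongr
          · exact (norm_inner_le_norm _ _).trans (by gcongr; exact hε i)
          · exact hdev i
      _ = _ := by ring
  · set w := toEuclideanLin (covPP G u) q with hw
    set B := toEuclideanLin (extCov Γ S)⁻¹ with hBdef
    have h1 : B r = B w + h⁻¹ • q := by
      rw [← hMq, hMat, map_add, LinearMap.add_apply, map_smul, LinearMap.smul_apply, map_add,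
        map_smul, hBdef, (posDef_extCov hΓ hS).toEuclideanLin_apply_inv]
    have h2 : gradient (loss G y Γ S) m = (2 : ℝ) • ContinuousLinearMap.adjoint J (B r) := by
      refine ext_inner_right ℝ fun d => ?_
      rw [inner_gradient_loss hΓ hS hd, inner_smul_left, ContinuousLinearMap.adjoint_inner_left]
      rfl
    have h3 : (h / 2) • gradient (loss G y Γ S) m - v
        = h • ContinuousLinearMap.adjoint J (B w) := by
      rw [h2, h1, map_add, map_smul, ← hv, smul_add, smul_add, smul_smul, smul_smul, smul_smul]
      have h4 : h / 2 * 2 * h⁻¹ = 1 := by field_simp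
      have h5 : h / 2 * 2 = h := by ring
      rw [h4, h5, one_smul]; abel
    have h6 : w - J (toEuclideanLin (covUU u) v) = avg fun i =>
        inner ℝ (p i) q • p i - inner ℝ (J (dev u i)) q • J (dev u i) := by
      have h7 := map_avg J.toLinearMap
        (fun i => inner ℝ (dev u i) v • dev u i)
      simp only [ContinuousLinearMap.coe_coe, map_smul, hvin] at h7
      rw [avg_sub, ← h7, hw, covPP, toEuclideanLin_sampleCov, covUU, toEuclideanLin_sampleCov]
      congr 3
      ext1 i
      rw [← hvin]; rfl
    have h8 : ‖w - J (toEuclideanLin (covUU u) v)‖ ≤ 6 * M ^ 2 * ρ ^ 3 * ‖q‖ := by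
      rw [h6]
      refine norm_avg_le (by positivity) fun i => ?_
      have h9 : inner ℝ (p i) q • p i - inner ℝ (J (dev u i)) q • J (dev u i)
          = inner ℝ (p i - J (dev u i)) q • p i
            + inner ℝ (J (dev u i)) q • (p i - J (dev u i)) := by
        rw [inner_sub_left]; module
      rw [h9]
      calc _ ≤ (2 * M * ρ ^ 2 * ‖q‖) * (2 * M * ρ) + (M * ρ * ‖q‖) * (2 * M * ρ ^ 2) := by
            refine norm_add_le_of_le ?_ ?_ <;> rw [norm_smul]
            · gcongr
              · exact (norm_inner_le_norm _ _).trans (by gcongr; exact hε i)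
              · exact hpn i
            · gcongr
              · exact (norm_inner_le_norm _ _).trans (by gcongr; exact hJdev i)
              · exact hε i
        _ = _ := by ring
    have h10 : ‖w‖ ≤ M * ρ ^ 2 * ‖v‖ + 6 * M ^ 2 * ρ ^ 3 * ‖q‖ := by
      have h11 : ‖J (toEuclideanLin (covUU u) v)‖ ≤ M * ρ ^ 2 * ‖v‖ := by
        rw [mul_assoc]
        exact (hJd _).trans (by gcongr; exact norm_toEuclideanLin_covUU_le hρ hdev v)
      have h12 : w = J (toEuclideanLin (covUU u) v)
          + (w - J (toEuclideanLin (covUU u) v)) := by abel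
      rw [h12]
      exact norm_add_le_of_le h11 h8
    rw [h3, norm_smul, Real.norm_of_nonneg hh.le]
    calc _ ≤ h * (M * (b * ‖w‖)) := by
          gcongr
          exact (hJa _).trans (by gcongr; exact hB w)
      _ = h * (M * b) * ‖w‖ := by ring
      _ ≤ _ := by gcongr

end MeanStep

section Run

variable {du dy K : ℕ} {G : EuclideanSpace ℝ (Fin du) → EuclideanSpace ℝ (Fin dy)}
  {y : EuclideanSpace ℝ (Fin dy)} {Γ : Matrix (Fin dy) (Fin dy) ℝ}
  {S : Matrix (Fin du) (Fin du) ℝ} {h₀ β γ : ℝ} {h a : ℕ → ℝ}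
  {u : ℕ → Fin K → EuclideanSpace ℝ (Fin du)}

theorem tendsto_natCast_rpow_of_neg {p : ℝ} (hp : p < 0) :
    Tendsto (fun n : ℕ => (n : ℝ) ^ p) atTop (𝓝 0) := by
  have := (tendsto_rpow_neg_atTop (neg_pos.2 hp)).comp tendsto_natCast_atTop_atTop
  simpa [Function.comp_def] using this

theorem posDef_covUU_of_le (hS : S.PosDef) {k : ℝ} (hk : 0 < k)
    {x : Fin K → EuclideanSpace ℝ (Fin du)}
    (h : ∀ v, k * inner ℝ v (toEuclideanLin S v) ≤ inner ℝ v (toEuclideanLin (covUU x) v)) :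
    (covUU x).PosDef := by
  refine PosDef.of_dotProduct_mulVec_pos (posSemidef_sampleCov x).isHermitian fun v hv => ?_
  have h1 := h (toLp 2 v)
  rw [inner_toEuclideanLin, inner_toEuclideanLin] at h1
  have h2 := hS.dotProduct_mulVec_pos hv
  rw [star_trivial] at h2 ⊢
  exact (mul_pos hk h2).trans_le h1

/-- With the covariance rescaled by `n ^ (γ - β - 1)`, the means follow a perturbed preconditioned
gradient descent for the loss with steps `n ^ (γ - 1)`. -/
theorem IsEKI.exists_isPreconditionedDescent (hΓ : Γ.PosDef) (hS : S.PosDef)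
    (hH : HasBoundedDerivs (obs G)) (hh₀ : 0 < h₀) (hβγ : γ - 1 ≤ β) (hγ₁ : γ < 1)
    (hpos : ∀ n, 0 < h n) (hh : ∀ n : ℕ, 1 ≤ n → h n = h₀ * (n : ℝ) ^ β)
    (hu : IsEKI G y Γ S h a u) {κ κM B : ℝ} (hκ : 0 < κ) (hκM : 0 < κM) (hB : 0 < B)
    (hlb : CovLowerBound S β γ u κ) (hub : CovUpperBound S β γ u κM)
    (hratio : ∀ n : ℕ, 1 ≤ n → ∀ v, inner ℝ v (toEuclideanLin (covUU (u n)) v)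
      ≤ (1 + B * (n : ℝ) ^ (γ - 1)) * inner ℝ v (toEuclideanLin (covUU (u (n + 1))) v)) :
    ∃ (ω : ℕ → EuclideanSpace ℝ (Fin du)) (R : ℝ) (n₁ : ℕ), 1 ≤ n₁ ∧
      IsPreconditionedDescent (loss G y Γ S) (fun n => sampleMean (u n))
        (fun n => ((n : ℝ) ^ (γ - β - 1))⁻¹ • toEuclideanLin (covUU (u n)))
        (fun n => (n : ℝ) ^ (γ - β - 1) • toEuclideanLin (covUU (u n))⁻¹) ω
        (fun n => (n : ℝ) ^ (γ - 1)) (fun n => (n : ℝ) ^ ((γ - β - 1) / 2)) (h₀ / 2) R n₁ := by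
  obtain ⟨M, hM, hJ, hLip, hTay⟩ := hH.exists_bound
  obtain ⟨σ, hσ, hσ'⟩ := (posDef_extCov hΓ hS).exists_pos_le_inner
  obtain ⟨b, hb, hBn⟩ := exists_norm_toEuclideanLin_le (extCov Γ S)⁻¹
  obtain ⟨ν, hν, hres⟩ := exists_norm_resid_le hΓ hS G y
  obtain ⟨r, hr, hdev⟩ := exists_norm_dev_le hS hκM hub
  obtain ⟨s, hs, hSs⟩ := hS.exists_pos_le_inner
  rw [covLowerBound_iff hS] at hlb
  set τ : ℕ → ℝ := fun n => (n : ℝ) ^ (γ - β - 1) with hτ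
  set t : ℕ → ℝ := fun n => (n : ℝ) ^ (γ - 1) with ht
  set e : ℕ → ℝ := fun n => (n : ℝ) ^ ((γ - β - 1) / 2) with he
  set f := loss G y Γ S with hf
  set m : ℕ → EuclideanSpace ℝ (Fin du) := fun n => sampleMean (u n) with hm
  have hτ0 : ∀ n : ℕ, 1 ≤ n → 0 < τ n := fun n hn => by
    have : (0 : ℝ) < n := by exact_mod_cast hn
    positivity
  have ht0 : ∀ n : ℕ, 1 ≤ n → 0 < t n := fun n hn => by
    have : (0 : ℝ) < n := by exact_mod_cast hn
    positivity
  have he0 : ∀ n : ℕ, 1 ≤ n → 0 < e n := fun n hn => by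
    have : (0 : ℝ) < n := by exact_mod_cast hn
    positivity
  have ht1 : ∀ n : ℕ, 1 ≤ n → t n ≤ 1 := fun n hn => rpow_sub_one_le_one hγ₁ hn
  have he1 : ∀ n : ℕ, 1 ≤ n → e n ≤ 1 := fun n hn =>
    Real.rpow_le_one_of_one_le_of_nonpos (by exact_mod_cast hn) (by linarith)
  have hee : ∀ n, e n ^ 2 = τ n := fun n => rpow_half_sq _ n
  have hhτ : ∀ n : ℕ, 1 ≤ n → h n * τ n = h₀ * t n := fun n hn => by
    rw [hh n hn]; exact mul_rpow_mul_rpow h₀ β γ hn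
  have hpd : ∀ n : ℕ, 1 ≤ n → (covUU (u n)).PosDef := fun n hn =>
    posDef_covUU_of_le hS (mul_pos hκ (hτ0 n hn)) (hlb n hn)
  have hCle : ∀ n : ℕ, 1 ≤ n → ∀ v, ‖toEuclideanLin (covUU (u n)) v‖ ≤ r ^ 2 * τ n * ‖v‖ := by
    intro n hn v
    have := norm_toEuclideanLin_covUU_le (by have := he0 n hn; positivity) (hdev n hn) v
    rwa [mul_pow, rpow_half_sq] at this
  have hCinv : ∀ n : ℕ, 1 ≤ n → ∀ v,
      ‖toEuclideanLin (covUU (u n))⁻¹ v‖ ≤ (κ * s * τ n)⁻¹ * ‖v‖ := by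
    intro n hn v
    set w := toEuclideanLin (covUU (u n))⁻¹ v with hw
    have h1 : toEuclideanLin (covUU (u n)) w = v := (hpd n hn).toEuclideanLin_inv_apply v
    have hτn := hτ0 n hn
    rw [le_inv_mul_iff₀ (by positivity)]
    have h2 : κ * s * τ n * ‖w‖ ^ 2 ≤ ‖w‖ * ‖v‖ := by
      calc _ = κ * τ n * (s * ‖w‖ ^ 2) := by ring
        _ ≤ κ * τ n * inner ℝ w (toEuclideanLin S w) := by gcongr; exact hSs w
        _ ≤ inner ℝ w v := by
          have := hlb n hn w
          rwa [h1] at this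
        _ ≤ _ := real_inner_le_norm _ _
    rcases (norm_nonneg w).eq_or_lt with h3 | h3
    · rw [← h3, mul_zero]; exact norm_nonneg _
    · refine le_of_mul_le_mul_left ?_ h3
      linarith
  choose! v q hq hinn hgrad using fun n (hn : 1 ≤ n) => exists_innovation_approx (y := y) hΓ hS hM
    hH.1 hJ hLip hTay hσ hb hσ' hBn hres (hpos n) (by have := he0 n hn; positivity) (hdev n hn)
  set a₁ := M * b * M * r ^ 2 with ha₁
  set a₂ := 6 * M ^ 3 * b * r ^ 3 with ha₂
  set a₃ := 2 * M * r ^ 3 / (κ * s) with ha₃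
  set ω₀ : ℕ → EuclideanSpace ℝ (Fin du) := fun n => v n - (h n / 2) • gradient f (m n)
    + toEuclideanLin (covUU (u n))⁻¹
      (innovation G y Γ S (h n) (u n) - toEuclideanLin (covUU (u n)) (v n)) with hω₀
  obtain ⟨n₂, hn₂⟩ : ∃ n₂ : ℕ, ∀ n ≥ n₂, t n * (a₁ * h₀) ≤ 1 / 2 := by
    have h1 := (tendsto_natCast_rpow_of_neg (show γ - 1 < 0 by linarith)).mul_const (a₁ * h₀)
    rw [zero_mul] at h1
    exact eventually_atTop.1 ((h1.eventually_lt_const (show (0 : ℝ) < 1 / 2 by norm_num)).mono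
      fun n hn => hn.le)
  have hω : ∀ n : ℕ, 1 ≤ n → n₂ ≤ n → ‖ω₀ n‖ ≤ h n * (a₁ * h₀ * (t n * ‖gradient f (m n)‖)
      + (2 * a₂ * h₀ + a₃) * (ν / σ) * (e n * √(f (m n)))) := by
    intro n hn hn2
    have hhn := hpos n
    have htn := ht0 n hn
    have hen := he0 n hn
    have hτn := hτ0 n hn
    set g := gradient f (m n) with hg
    set X := ‖(h n / 2) • g - v n‖ with hX
    have hρ2 : (r * e n) ^ 2 = r ^ 2 * τ n := by rw [mul_pow, hee]
    have hρ3 : (r * e n) ^ 3 = r ^ 3 * (τ n * e n) := by rw [← hee]; ring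
    have hq0 : 0 ≤ q n := by
      have h1 := (norm_nonneg _).trans (hinn n hn)
      exact nonneg_of_mul_nonneg_right h1 (by positivity)
    have hX1 : X ≤ t n * (a₁ * h₀) * ‖v n‖ + a₂ * h₀ * (t n * (e n * q n)) := by
      have h1 := hgrad n hn
      refine h1.trans_eq ?_
      change h n * (M * b) * (M * (r * e n) ^ 2 * ‖v n‖ + 6 * M ^ 2 * (r * e n) ^ 3 * q n) = _
      rw [hρ2, hρ3, ha₁, ha₂]
      linear_combination (M * b * M * r ^ 2 * ‖v n‖ + 6 * M ^ 3 * b * r ^ 3 * (e n * q n))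
        * hhτ n hn
    have hvn : ‖v n‖ ≤ h n / 2 * ‖g‖ + X := by
      have h1 : v n = (h n / 2) • g - ((h n / 2) • g - v n) := by abel
      calc ‖v n‖ ≤ ‖(h n / 2) • g‖ + X := by nth_rw 1 [h1]; exact norm_sub_le _ _
        _ = _ := by rw [norm_smul, Real.norm_of_nonneg (by positivity)]
    have hX2 : X ≤ h n * (a₁ * h₀ * (t n * ‖g‖)) + 2 * a₂ * h₀ * (e n * q n) := by
      have h1 : t n * (a₁ * h₀) * X ≤ 1 / 2 * X := by
        gcongr; exact hn₂ n hn2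
      have h2 : t n * (a₁ * h₀) * ‖v n‖ ≤ t n * (a₁ * h₀) * (h n / 2 * ‖g‖ + X) := by gcongr
      have h3 : a₂ * h₀ * (t n * (e n * q n)) ≤ a₂ * h₀ * (1 * (e n * q n)) := by
        gcongr; exact ht1 n hn
      linarith
    have hZ : ‖toEuclideanLin (covUU (u n))⁻¹
        (innovation G y Γ S (h n) (u n) - toEuclideanLin (covUU (u n)) (v n))‖
        ≤ a₃ * (e n * q n) := by
      have h1 := hinn n hn
      change _ ≤ 2 * M * (r * e n) ^ 3 * q n at h1
      rw [hρ3] at h1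
      calc _ ≤ (κ * s * τ n)⁻¹ * (2 * M * (r ^ 3 * (τ n * e n)) * q n) :=
            (hCinv n hn _).trans (by gcongr)
        _ = _ := by rw [ha₃]; field_simp
    have h4 : ‖ω₀ n‖ ≤ X + a₃ * (e n * q n) := by
      refine norm_add_le_of_le ?_ hZ
      rw [← norm_neg, neg_sub]
    have h5 : (2 * a₂ * h₀ + a₃) * (e n * q n)
        ≤ (2 * a₂ * h₀ + a₃) * (e n * (h n / σ * (ν * √(f (m n))))) := by
      gcongr; exact hq n hn
    calc _ ≤ h n * (a₁ * h₀ * (t n * ‖g‖)) + (2 * a₂ * h₀ + a₃) * (e n * q n) := by linarith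
      _ ≤ h n * (a₁ * h₀ * (t n * ‖g‖))
          + (2 * a₂ * h₀ + a₃) * (e n * (h n / σ * (ν * √(f (m n))))) := by linarith
      _ = _ := by ring
  set R := h₀ * (a₁ * h₀ + (2 * a₂ * h₀ + a₃) * (ν / σ)) + r ^ 2 + (κ * s)⁻¹ + B with hR
  have hR1 : h₀ * (a₁ * h₀) ≤ R := by
    have : 0 ≤ h₀ * ((2 * a₂ * h₀ + a₃) * (ν / σ)) + r ^ 2 + (κ * s)⁻¹ + B := by positivity
    linarith
  have hR2 : h₀ * ((2 * a₂ * h₀ + a₃) * (ν / σ)) ≤ R := by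
    have : 0 ≤ h₀ * (a₁ * h₀) + r ^ 2 + (κ * s)⁻¹ + B := by positivity
    linarith
  have hR3 : r ^ 2 ≤ R := by
    have : 0 ≤ h₀ * (a₁ * h₀ + (2 * a₂ * h₀ + a₃) * (ν / σ)) + (κ * s)⁻¹ + B := by positivity
    linarith
  have hR4 : (κ * s)⁻¹ ≤ R := by
    have : 0 ≤ h₀ * (a₁ * h₀ + (2 * a₂ * h₀ + a₃) * (ν / σ)) + r ^ 2 + B := by positivity
    linarith
  have hR5 : B ≤ R := by
    have : 0 ≤ h₀ * (a₁ * h₀ + (2 * a₂ * h₀ + a₃) * (ν / σ)) + r ^ 2 + (κ * s)⁻¹ := by positivity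
    linarith
  have hRpos : 0 < R := hB.trans_le hR5
  refine ⟨fun n => (h₀ / h n) • ω₀ n, R, max 1 n₂, le_max_left _ _, ?_⟩
  have hge : ∀ n ≥ max 1 n₂, 1 ≤ n := fun n hn => (le_max_left _ _).trans hn
  refine
    { pos := hRpos
      rate_pos := by positivity
      t_mem := fun n hn => ⟨(ht0 n (hge n hn)).le, ht1 n (hge n hn)⟩
      e_mem := fun n hn => ⟨(he0 n (hge n hn)).le, he1 n (hge n hn)⟩
      step := fun n hn => ?_
      norm_err := fun n hn => ?_
      norm_P := fun n hn w => ?_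
      A_P := fun n hn w => ?_
      A_symm := fun n hn w w' => ?_
      le_A := fun n hn w => ?_
      A_le := fun n hn w => ?_
      A_succ := fun n hn w => ?_ }
  all_goals have hn1 := hge n hn
  all_goals have hhn := hpos n
  all_goals have htn := ht0 n hn1
  all_goals have hen := he0 n hn1
  all_goals have hτn := hτ0 n hn1
  · change m (n + 1) = m n - t n • ((τ n)⁻¹ • toEuclideanLin (covUU (u n))
      ((h₀ / 2) • gradient f (m n) + (h₀ / h n) • ω₀ n))
    have h1 : t n * (τ n)⁻¹ * (h₀ / h n) = 1 := by
      rw [eq_comm]; field_simp; linarith [hhτ n hn1]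
    have h2 : (h₀ / 2) • gradient f (m n) + (h₀ / h n) • ω₀ n
        = (h₀ / h n) • ((h n / 2) • gradient f (m n) + ω₀ n) := by
      rw [smul_add (h₀ / h n) _ (ω₀ n), smul_smul]; congr 2; field_simp
    have h3 : toEuclideanLin (covUU (u n)) ((h n / 2) • gradient f (m n) + ω₀ n)
        = innovation G y Γ S (h n) (u n) := by
      have h4 : (h n / 2) • gradient f (m n) + ω₀ n = v n + toEuclideanLin (covUU (u n))⁻¹
          (innovation G y Γ S (h n) (u n) - toEuclideanLin (covUU (u n)) (v n)) := by
        simp only [hω₀]; abel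
      rw [h4, map_add, (hpd n hn1).toEuclideanLin_inv_apply]; abel
    rw [h2, map_smul, h3, smul_smul, smul_smul, h1, one_smul]
    exact hu.sampleMean_succ n
  · change ‖(h₀ / h n) • ω₀ n‖ ≤ R * (t n * ‖gradient f (m n)‖ + e n * √(f (m n)))
    rw [norm_smul, Real.norm_of_nonneg (by positivity)]
    calc _ ≤ h₀ / h n * (h n * (a₁ * h₀ * (t n * ‖gradient f (m n)‖)
          + (2 * a₂ * h₀ + a₃) * (ν / σ) * (e n * √(f (m n))))) := by
          gcongr; exact hω n hn1 ((le_max_right _ _).trans hn)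
      _ = h₀ * (a₁ * h₀) * (t n * ‖gradient f (m n)‖)
          + h₀ * ((2 * a₂ * h₀ + a₃) * (ν / σ)) * (e n * √(f (m n))) := by field_simp
      _ ≤ R * (t n * ‖gradient f (m n)‖) + R * (e n * √(f (m n))) := by gcongr
      _ = _ := by ring
  · rw [LinearMap.smul_apply, norm_smul, Real.norm_of_nonneg (by positivity)]
    calc _ ≤ (τ n)⁻¹ * (r ^ 2 * τ n * ‖w‖) := by gcongr; exact hCle n hn1 w
      _ = r ^ 2 * ‖w‖ := by field_simp
      _ ≤ _ := by gcongr
  · rw [LinearMap.smul_apply, LinearMap.smul_apply, map_smul, smul_smul,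
      (hpd n hn1).toEuclideanLin_apply_inv]
    change (τ n * (τ n)⁻¹) • w = w
    rw [mul_inv_cancel₀ hτn.ne', one_smul]
  · rw [LinearMap.smul_apply, LinearMap.smul_apply, inner_smul_left, inner_smul_right,
      (hpd n hn1).inv.isHermitian.inner_toEuclideanLin_comm]
    rfl
  · rw [LinearMap.smul_apply, inner_smul_right]
    change ‖w‖ ^ 2 ≤ R * (τ n * _)
    have h1 := (hpd n hn1).two_mul_inner_sub_le w ((r ^ 2 * τ n)⁻¹ • w)
    rw [map_smul, inner_smul_left, inner_smul_left, inner_smul_right, real_inner_self_eq_norm_sq]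
      at h1
    simp only [conj_trivial] at h1
    have h2 : inner ℝ w (toEuclideanLin (covUU (u n)) w) ≤ r ^ 2 * τ n * ‖w‖ ^ 2 := by
      calc _ ≤ ‖w‖ * (r ^ 2 * τ n * ‖w‖) :=
            (real_inner_le_norm _ _).trans (by gcongr; exact hCle n hn1 w)
        _ = _ := by ring
    have h3 : (r ^ 2 * τ n)⁻¹ * ((r ^ 2 * τ n)⁻¹ * inner ℝ w (toEuclideanLin (covUU (u n)) w))
        ≤ (r ^ 2 * τ n)⁻¹ * ((r ^ 2 * τ n)⁻¹ * (r ^ 2 * τ n * ‖w‖ ^ 2)) := by gcongr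
    rw [inv_mul_cancel_left₀ (by positivity)] at h3
    have h4 : (r ^ 2 * τ n)⁻¹ * ‖w‖ ^ 2
        ≤ inner ℝ w (toEuclideanLin (covUU (u n))⁻¹ w) := by linarith
    have h5 : 0 ≤ inner ℝ w (toEuclideanLin (covUU (u n))⁻¹ w) := le_trans (by positivity) h4
    rw [inv_mul_le_iff₀ (by positivity)] at h4
    calc _ ≤ r ^ 2 * (τ n * inner ℝ w (toEuclideanLin (covUU (u n))⁻¹ w)) := by linarith
      _ ≤ _ := by gcongr
  · rw [LinearMap.smul_apply, inner_smul_right]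
    change τ n * _ ≤ _
    calc _ ≤ τ n * (‖w‖ * ((κ * s * τ n)⁻¹ * ‖w‖)) := by
          gcongr
          exact (real_inner_le_norm _ _).trans (by gcongr; exact hCinv n hn1 w)
      _ = (κ * s)⁻¹ * ‖w‖ ^ 2 := by field_simp
      _ ≤ _ := by gcongr
  · rw [LinearMap.smul_apply, inner_smul_right, LinearMap.smul_apply, inner_smul_right]
    change τ (n + 1) * _ ≤ (1 + R * t n) * (τ n * _)
    have h1 := (hpd n hn1).inner_inv_le (hpd (n + 1) (by omega))
      (show 0 < 1 + B * t n by positivity) (hratio n hn1) w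
    have h2 := (posSemidef_iff_inner.1 (hpd n hn1).inv.posSemidef).2 w
    have h3 := (posSemidef_iff_inner.1 (hpd (n + 1) (by omega)).inv.posSemidef).2 w
    calc _ ≤ τ n * ((1 + B * t n) * inner ℝ w (toEuclideanLin (covUU (u n))⁻¹ w)) := by
          gcongr
          exact rpow_succ_le (by linarith) hn1
      _ ≤ τ n * ((1 + R * t n) * inner ℝ w (toEuclideanLin (covUU (u n))⁻¹ w)) := by gcongr
      _ = _ := by ring

end Run

/-! ### Convergence rates -/

/-- A recursion with contraction `1 - μ t n` and perturbation `D t n n⁻ᵃ` decays like `n⁻ᵃ`, as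
long as `a / n` stays below `μ t n` by a fixed fraction of `t n`. -/
theorem exists_le_rpow_neg_of_recursion {E t : ℕ → ℝ} {μ δ D p : ℝ} (hδ : 0 < δ) (hD : 0 ≤ D)
    (hp₀ : 0 ≤ p) (hp₁ : p ≤ 1) (ht : ∀ᶠ n in atTop, 0 ≤ t n) (hμt : ∀ᶠ n in atTop, μ * t n ≤ 1)
    (hpt : ∀ᶠ n : ℕ in atTop, p / n ≤ (μ - δ) * t n)
    (hE : ∀ᶠ n : ℕ in atTop, E (n + 1) ≤ (1 - μ * t n) * E n + D * (t n * (n : ℝ) ^ (-p))) :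
    ∃ (n₀ : ℕ) (D' : ℝ), 0 ≤ D' ∧ ∀ n ≥ n₀, E n ≤ D' * (n : ℝ) ^ (-p) := by
  obtain ⟨n₀, hn₀⟩ := eventually_atTop.1
    ((ht.and (hμt.and (hpt.and hE))).and (eventually_ge_atTop 1))
  have hn₀1 : 1 ≤ n₀ := (hn₀ n₀ le_rfl).2
  have hn₀pos : (0 : ℝ) < n₀ := by exact_mod_cast hn₀1
  set D' := max (D / δ) (E n₀ * (n₀ : ℝ) ^ p) with hD'
  have hD'0 : 0 ≤ D' := le_trans (by positivity) (le_max_left _ _)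
  have hDD' : D ≤ D' * δ := by
    rw [← div_le_iff₀ hδ]; exact le_max_left _ _
  refine ⟨n₀, D', hD'0, fun n hn => ?_⟩
  induction n, hn using Nat.le_induction with
  | base =>
    calc E n₀ = E n₀ * (n₀ : ℝ) ^ p * (n₀ : ℝ) ^ (-p) := by
          rw [mul_assoc, ← Real.rpow_add hn₀pos, add_neg_cancel, Real.rpow_zero, mul_one]
      _ ≤ _ := by gcongr; exact le_max_right _ _
  | succ n hn ih =>
    obtain ⟨⟨h1, h2, h3, h4⟩, h5⟩ := hn₀ n hn
    have hn' : (1 : ℝ) ≤ n := by exact_mod_cast h5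
    have h6 := rpow_neg_le_mul_rpow_neg_succ hp₀ hp₁ h5
    have h7 : p / n ≤ 1 := (div_le_one (by linarith)).2 (hp₁.trans hn')
    calc E (n + 1) ≤ (1 - μ * t n) * (D' * (n : ℝ) ^ (-p)) + D' * δ * (t n * (n : ℝ) ^ (-p)) := by
          refine h4.trans (add_le_add (mul_le_mul_of_nonneg_left ih (by linarith)) (by gcongr))
      _ = D' * (n : ℝ) ^ (-p) * (1 - (μ - δ) * t n) := by ring
      _ ≤ D' * (n : ℝ) ^ (-p) * (1 - p / n) := by gcongr
      _ ≤ D' * ((1 + p / n) * ((n + 1 : ℕ) : ℝ) ^ (-p)) * (1 - p / n) := by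
          gcongr
      _ = D' * ((n + 1 : ℕ) : ℝ) ^ (-p) * (1 - (p / n) ^ 2) := by ring
      _ ≤ D' * ((n + 1 : ℕ) : ℝ) ^ (-p) * 1 := by
          gcongr; linarith [sq_nonneg (p / (n : ℝ))]
      _ = _ := mul_one _

section Run

variable {du dy K : ℕ} {G : EuclideanSpace ℝ (Fin du) → EuclideanSpace ℝ (Fin dy)}
  {y : EuclideanSpace ℝ (Fin dy)} {Γ : Matrix (Fin dy) (Fin dy) ℝ}
  {S : Matrix (Fin du) (Fin du) ℝ} {h₀ β γ : ℝ} {h a : ℕ → ℝ}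
  {u : ℕ → Fin K → EuclideanSpace ℝ (Fin du)}

theorem IsEKI.eventually_gap_le (hΓ : Γ.PosDef) (hS : S.PosDef)
    (hH : HasBoundedDerivs (obs G)) (hh₀ : 0 < h₀) (hβγ : γ - 1 < β) (hγ₁ : γ < 1)
    (hpos : ∀ n, 0 < h n) (hh : ∀ n : ℕ, 1 ≤ n → h n = h₀ * (n : ℝ) ^ β)
    (hu : IsEKI G y Γ S h a u) {c : ℝ} (hc : 0 < c)
    (hconv : StronglyConvexWith (loss G y Γ S) c) {κ κM B σ : ℝ} (hκ : 0 < κ) (hκM : 0 < κM)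
    (hB : 0 < B) (hlb : CovLowerBound S β γ u κ) (hub : CovUpperBound S β γ u κM)
    (hratio : ∀ n : ℕ, 1 ≤ n → ∀ v, inner ℝ v (toEuclideanLin (covUU (u n)) v)
      ≤ (1 + B * (n : ℝ) ^ (γ - 1)) * inner ℝ v (toEuclideanLin (covUU (u (n + 1))) v))
    (hσ : 0 < σ) (hSσ : ∀ v, σ * ‖v‖ ^ 2 ≤ inner ℝ v (toEuclideanLin S v))
    (uStar : EuclideanSpace ℝ (Fin du)) :
    ∃ D : ℝ, 0 ≤ D ∧ ∀ᶠ n : ℕ in atTop,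
      loss G y Γ S (sampleMean (u (n + 1))) - loss G y Γ S uStar
        ≤ (1 - 3 / 2 * (h₀ * κ * σ * c) * (n : ℝ) ^ (γ - 1))
            * (loss G y Γ S (sampleMean (u n)) - loss G y Γ S uStar)
          + D * ((n : ℝ) ^ (γ - 1) * (n : ℝ) ^ (-((1 + β - γ) / 2))) := by
  obtain ⟨ω, R, n₁, hn₁, hdesc⟩ := hu.exists_isPreconditionedDescent hΓ hS hH hh₀ hβγ.le hγ₁ hpos hh
    hκ hκM hB hlb hub hratio
  obtain ⟨L, hL⟩ := exists_hasQuadraticGrowth_loss (y := y) hΓ hS hH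
  have hcont : Continuous (loss G y Γ S) :=
    continuous_iff_continuousAt.2 fun x => (hasFDerivAt_loss hΓ hS hH.1 x).continuousAt
  rw [covLowerBound_iff hS] at hlb
  obtain ⟨D, hD, hev⟩ := hdesc.eventually_gap_le hconv hc hcont hL
    (tendsto_natCast_rpow_of_neg (by linarith)) (tendsto_natCast_rpow_of_neg (by linarith))
    (mul_pos hκ hσ) (fun n hn v => by
      have hn' : (0 : ℝ) < n := by exact_mod_cast hn₁.trans hn
      rw [LinearMap.smul_apply, inner_smul_right, le_inv_mul_iff₀ (by positivity)]
      refine le_trans ?_ (hlb n (hn₁.trans hn) v)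
      calc _ = κ * (n : ℝ) ^ (γ - β - 1) * (σ * ‖v‖ ^ 2) := by ring
        _ ≤ _ := by gcongr; exact hSσ v) uStar
  refine ⟨D, hD, hev.mono fun n hn => hn.trans_eq ?_⟩
  rw [show -((1 + β - γ) / 2) = (γ - β - 1) / 2 by ring]
  ring

end Run

theorem le_div_rpow_of_le_mul_rpow_neg {x D p α : ℝ} (hD : 0 ≤ D) (hα : α ≤ p) {N : ℕ}
    (hN : 1 ≤ N) (hx : x ≤ D * (N : ℝ) ^ (-p)) : x ≤ D / (N : ℝ) ^ α := by
  refine hx.trans ?_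
  rw [div_eq_mul_inv, ← Real.rpow_neg (Nat.cast_nonneg N)]
  gcongr
  exact_mod_cast hN

end EKI

open EKI in
theorem mainTheorem6 {du dy K : ℕ}
    (G : EuclideanSpace ℝ (Fin du) → EuclideanSpace ℝ (Fin dy))
    (y : EuclideanSpace ℝ (Fin dy))
    (Γ : Matrix (Fin dy) (Fin dy) ℝ) (S : Matrix (Fin du) (Fin du) ℝ)
    (hΓ : Γ.PosDef) (hS : S.PosDef)
    (hH : EKI.HasBoundedDerivs (EKI.obs G))
    (h₀ α₀ β γ : ℝ) (hh₀ : 0 < h₀) (hα₀ : 0 < α₀)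
    (hβγ : γ - 1 ≤ β) (hβγ' : β ≤ γ) (hγ₀ : 0 ≤ γ) (hγ₁ : γ < 1)
    -- step sizes `h_n` and inflation factors `a_n = α_n²`
    (h a : ℕ → ℝ) (hpos : ∀ n, 0 < h n) (apos : ∀ n, 0 < a n)
    (hh : ∀ n : ℕ, 1 ≤ n → h n = h₀ * (n : ℝ) ^ β)
    (ha : ∀ n : ℕ, 1 ≤ n → a n = α₀ ^ 2 * h₀⁻¹ * (n : ℝ) ^ (2 * γ - β - 2))
    (u : ℕ → Fin K → EuclideanSpace ℝ (Fin du))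
    (hu : EKI.IsEKI G y Γ S h a u)
    (c : ℝ) (hc : 0 < c) (hconv : EKI.StronglyConvexWith (EKI.loss G y Γ S) c) :
    -- the constants `κ_m`, `κ_M` exist
    (∃ κm κM : ℝ, 0 < κm ∧ 0 < κM ∧
      EKI.CovLowerBound S β γ u κm ∧ EKI.CovUpperBound S β γ u κM) ∧
    -- the minimizer `u*`
    ∃ uStar : EuclideanSpace ℝ (Fin du),
      (∀ x, x ≠ uStar → EKI.loss G y Γ S uStar < EKI.loss G y Γ S x) ∧
      (∀ N : ℕ, c * ‖EKI.sampleMean (u N) - uStar‖ ^ 2 ≤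
        EKI.loss G y Γ S (EKI.sampleMean (u N)) - EKI.loss G y Γ S uStar) ∧
      (γ = 0 → ∀ κm : ℝ, 0 < κm → EKI.CovLowerBound S β γ u κm →
        ∃ (n₀ : ℕ) (D : ℝ), ∀ α : ℝ, 0 < α →
          α < min ((1 + β) / 2) (h₀ * κm * EKI.minEigenvalue hS.isHermitian * c) →
          ∀ N : ℕ, n₀ ≤ N →
            EKI.loss G y Γ S (EKI.sampleMean (u N)) - EKI.loss G y Γ S uStar
              ≤ D / (N : ℝ) ^ α) ∧
      (0 < γ →
        ∃ (n₀ : ℕ) (D : ℝ), ∀ α : ℝ, 0 < α → α < (1 + β - γ) / 2 →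
          ∀ N : ℕ, n₀ ≤ N →
            EKI.loss G y Γ S (EKI.sampleMean (u N)) - EKI.loss G y Γ S uStar
              ≤ D / (N : ℝ) ^ α) := by
  obtain ⟨M, hM, -, hLip, -⟩ := hH.exists_bound
  obtain ⟨κM, hκM, hub⟩ := exists_covUpperBound hΓ hS hh₀ hβγ hβγ' hγ₀ hγ₁ hpos hh ha hu
  obtain ⟨B, hB, hratio₀⟩ := exists_inner_covUU_le hΓ hS hh₀ hM hLip hpos hh hu hκM hub
  obtain ⟨κm, hκm, hlb⟩ := exists_covLowerBound hΓ hS hh₀ hα₀ hβγ hpos apos ha hu hB hratio₀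
  have hratio : ∀ n : ℕ, 1 ≤ n → ∀ v, inner ℝ v (toEuclideanLin (covUU (u n)) v)
      ≤ (1 + B * (n : ℝ) ^ (γ - 1)) * inner ℝ v (toEuclideanLin (covUU (u (n + 1))) v) := by
    intro n hn v
    refine (hratio₀ n hn v).trans ?_
    have h1 := mul_nonneg (apos n).le ((posSemidef_iff_inner.1 hS.posSemidef).2 v)
    gcongr
    linarith
  have hcont : Continuous (loss G y Γ S) :=
    continuous_iff_continuousAt.2 fun x => (hasFDerivAt_loss hΓ hS hH.1 x).continuousAt
  obtain ⟨uStar, hmin⟩ := hconv.exists_minimizer hc hcont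
  have ht : ∀ᶠ n : ℕ in atTop, 0 ≤ (n : ℝ) ^ (γ - 1) :=
    Eventually.of_forall fun n => by positivity
  have hμt : ∀ μ : ℝ, ∀ᶠ n : ℕ in atTop, μ * (n : ℝ) ^ (γ - 1) ≤ 1 := by
    intro μ
    have h1 := (tendsto_natCast_rpow_of_neg (show γ - 1 < 0 by linarith)).const_mul μ
    rw [mul_zero] at h1
    exact (h1.eventually_lt_const one_pos).mono fun n hn => hn.le
  refine ⟨⟨κm, κM, hκm, hκM, hlb, hub⟩, uStar, fun x hx => ?_, fun N => hmin _, ?_, ?_⟩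
  · have h1 : 0 < ‖x - uStar‖ := norm_pos_iff.2 (sub_ne_zero.2 hx)
    have h2 : 0 < c * ‖x - uStar‖ ^ 2 := by positivity
    linarith [hmin x]
  · intro hγ κ hκ hlbκ
    set ρ := h₀ * κ * minEigenvalue hS.isHermitian * c with hρ
    -- otherwise there is no admissible exponent
    by_cases hadm : 0 < (1 + β) / 2 ∧ 0 < ρ
    swap
    · exact ⟨0, 0, fun α h1 h2 => absurd ⟨h1.trans (h2.trans_le (min_le_left _ _)),
        h1.trans (h2.trans_le (min_le_right _ _))⟩ hadm⟩
    obtain ⟨hβ, hρ0⟩ := hadm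
    have hσ : 0 < minEigenvalue hS.isHermitian := by
      by_contra hneg
      have : ρ ≤ 0 := mul_nonpos_of_nonpos_of_nonneg
        (mul_nonpos_of_nonneg_of_nonpos (by positivity) (not_lt.1 hneg)) hc.le
      linarith
    obtain ⟨D, hD, hrec⟩ := hu.eventually_gap_le hΓ hS hH hh₀ (by linarith) hγ₁ hpos hh hc hconv
      hκ hκM hB hlbκ hub hratio hσ (minEigenvalue_mul_norm_sq_le hS.isHermitian) uStar
    set p := min ((1 + β) / 2) ρ with hp
    have hp0 : 0 < p := lt_min hβ hρ0
    have hp1 : p ≤ (1 + β) / 2 := min_le_left _ _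
    have hpρ : p ≤ ρ := min_le_right _ _
    obtain ⟨n₀, D', hD', hE⟩ := exists_le_rpow_neg_of_recursion
      (E := fun n => loss G y Γ S (sampleMean (u n)) - loss G y Γ S uStar)
      (t := fun n : ℕ => (n : ℝ) ^ (γ - 1)) (μ := 3 / 2 * ρ) (half_pos hρ0) hD hp0.le
      (by linarith) ht (hμt _)
      (by
        refine Eventually.of_forall fun n => ?_
        rw [hγ, zero_sub, Real.rpow_neg_one, ← div_eq_mul_inv]
        gcongr
        linarith)
      (by
        filter_upwards [hrec, eventually_ge_atTop 1] with n hn hn1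
        refine hn.trans ?_
        gcongr
        · exact_mod_cast hn1
        · linarith)
    exact ⟨max 1 n₀, D', fun α _ hα N hN => le_div_rpow_of_le_mul_rpow_neg hD' hα.le
      ((le_max_left _ _).trans hN) (hE N ((le_max_right _ _).trans hN))⟩
  · intro hγ
    by_cases hβ : 0 < (1 + β - γ) / 2
    swap
    · exact ⟨0, 0, fun α h1 h2 => absurd (h1.trans h2) hβ⟩
    obtain ⟨σ, hσ, hSσ⟩ := hS.exists_pos_le_inner
    obtain ⟨D, hD, hrec⟩ := hu.eventually_gap_le hΓ hS hH hh₀ (by linarith) hγ₁ hpos hh hc hconv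
      hκm hκM hB hlb hub hratio hσ hSσ uStar
    set μ := 3 / 2 * (h₀ * κm * σ * c) with hμ
    have hμ0 : 0 < μ := by positivity
    obtain ⟨n₀, D', hD', hE⟩ := exists_le_rpow_neg_of_recursion
      (E := fun n => loss G y Γ S (sampleMean (u n)) - loss G y Γ S uStar)
      (t := fun n : ℕ => (n : ℝ) ^ (γ - 1)) (half_pos hμ0) hD hβ.le (by linarith) ht (hμt μ)
      (by
        -- `1 / n` is negligible against `n ^ (γ - 1)` since `γ > 0`
        have h1 := (tendsto_natCast_rpow_of_neg (neg_neg_of_pos hγ)).const_mul ((1 + β - γ) / 2)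
        rw [mul_zero] at h1
        filter_upwards [h1.eventually_lt_const (half_pos hμ0), eventually_ge_atTop 1] with n hn hn1
        have hn' : (0 : ℝ) < n := by exact_mod_cast hn1
        have h2 : (1 + β - γ) / 2 / n
            = (1 + β - γ) / 2 * (n : ℝ) ^ (-γ) * (n : ℝ) ^ (γ - 1) := by
          rw [mul_assoc, ← Real.rpow_add hn', show -γ + (γ - 1) = -1 by ring, Real.rpow_neg_one,
            div_eq_mul_inv _ (n : ℝ)]
        rw [h2]
        gcongr
        linarith) hrec
    exact ⟨max 1 n₀, D', fun α _ hα N hN => le_div_rpow_of_le_mul_rpow_neg hD' hα.le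
      ((le_max_left _ _).trans hN) (hE N ((le_max_right _ _).trans hN))⟩
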